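/- Let $a,b,c\in\mathbb{R}$ satisfy either ($c=0$ and $a\neq b$) or ($c>0$ and $a<b$). Put $Q(x)=ax(x-1)+bx+c$ and let $\nu_0$ be the largest real root of $Q$ (if $Q$ has no real root, read $\max\{0,\nu_0\}$ as $0$). Let $J_\nu$ be the Bessel function of the first kind, $N_\nu(z)=az^2J_\nu''(z)+bzJ_\nu'(z)+cJ_\nu(z)$, and let $g_\nu,h_\nu$ be the entire functions $$g_\nu(z)=\frac{2^\nu\Gamma(\nu+1)z^{1-\nu}}{Q(\nu)}N_\nu(z),\qquad h_\nu(z)=\frac{2^\nu\Gamma(\nu+1)z^{1-\nu/2}}{Q(\nu)}N_\nu(\sqrt z).$$ For an entire function $f$ with $f(0)=0$ and $f'(0)=1$ let $$r^c(f)=\sup\Big\{r>0:\ \operatorname{Re}\Big(1+\frac{zf''(z)}{f'(z)}\Big)>0\ \text{ for all } |z|<r\Big\}$$ be its radius of convexity. Suppose $\nu\ge\max\{0,\nu_0\}$ and $Q(\nu)\ne0$. Write $$K=81(\nu+2)Q(\nu+2)^2-25(\nu+1)Q(\nu)Q(\nu+4),\qquad H=16(\nu+2)Q(\nu+2)^2-9(\nu+1)Q(\nu)Q(\nu+4).$$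 Then: a) $$\frac23\sqrt{\frac{(\nu+1)Q(\nu)}{Q(\nu+2)}}<r^c(g_\nu)<\sqrt{\frac{36(\nu+1)(\nu+2)Q(\nu)Q(\nu+2)}{K}}$$ and $$\sqrt[4]{\frac{16(\nu+1)^2(\nu+2)Q(\nu)^2}{K}}<r^c(g_\nu)<\sqrt{\frac{8(\nu+1)(\nu+3)Q(\nu)\,K}{27(\nu+3)Q(\nu+2)\left[54(\nu+2)Q(\nu+2)^2-25(\nu+1)Q(\nu)Q(\nu+4)\right]+49(\nu+1)^2Q(\nu)^2Q(\nu+6)}}.$$ b) $$\frac{(\nu+1)Q(\nu)}{Q(\nu+2)}<r^c(h_\nu)<\frac{16(\nu+1)(\nu+2)Q(\nu)Q(\nu+2)}{H}$$ and $$\sqrt{\frac{16(\nu+1)^2(\nu+2)Q(\nu)^2}{H}}<r^c(h_\nu)<\frac{2(\nu+1)(\nu+3)Q(\nu)\,H}{(\nu+3)Q(\nu+2)\left[32(\nu+2)Q(\nu+2)^2-27(\nu+1)Q(\nu)Q(\nu+4)\right]+4(\nu+1)^2Q(\nu)^2Q(\nu+6)}.$$ -/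

import Mathlib

/-- The Bessel function of the first kind of real order `ν`,
`J_ν(z) = ∑ (-1)^n / (n! Γ(n+ν+1)) (z/2)^(2n+ν)`, with the principal branch of the power. -/
noncomputable def besselJ (ν : ℝ) (z : ℂ) : ℂ :=
  ∑' n : ℕ, (-1 : ℂ) ^ n / ((n.factorial : ℂ) * Complex.Gamma ((n : ℂ) + (ν : ℂ) + 1)) *
    (z / 2) ^ (2 * (n : ℂ) + (ν : ℂ))

/-- `N_ν(z) = a z² J_ν''(z) + b z J_ν'(z) + c J_ν(z)`. -/
noncomputable def besselN (a b c ν : ℝ) (z : ℂ) : ℂ :=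
  (a : ℂ) * z ^ 2 * deriv (deriv (besselJ ν)) z + (b : ℂ) * z * deriv (besselJ ν) z
    + (c : ℂ) * besselJ ν z

/-- The quadratic `Q(x) = a x (x - 1) + b x + c`. -/
def quadQ (a b c x : ℝ) : ℝ := a * x * (x - 1) + b * x + c

/-- `g_ν(z) = 2^ν Γ(ν+1) z^(1-ν) N_ν(z) / Q(ν)`. The formula with principal branches is used on
the plane cut along the non-positive reals, and the cut is filled in by continuity. -/
noncomputable def gNorm (a b c ν : ℝ) : ℂ → ℂ :=
  extendFrom Complex.slitPlane fun z : ℂ =>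
    (2 : ℂ) ^ (ν : ℂ) * Complex.Gamma ((ν : ℂ) + 1) * z ^ (1 - (ν : ℂ)) / (quadQ a b c ν : ℂ)
      * besselN a b c ν z

/-- `h_ν(z) = 2^ν Γ(ν+1) z^(1-ν/2) N_ν(√z) / Q(ν)`. The formula with principal branches is used on
the plane cut along the non-positive reals, and the cut is filled in by continuity. -/
noncomputable def hNorm (a b c ν : ℝ) : ℂ → ℂ :=
  extendFrom Complex.slitPlane fun z : ℂ =>
    (2 : ℂ) ^ (ν : ℂ) * Complex.Gamma ((ν : ℂ) + 1) * z ^ (1 - (ν : ℂ) / 2)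
      / (quadQ a b c ν : ℂ) * besselN a b c ν (z ^ (1 / 2 : ℂ))

/-- The radius of convexity of order `β`: the supremum of the `r > 0` such that `f` is analytic
in the open disk of radius `r` about `0` and `Re (1 + z f''(z) / f'(z)) > β` there (the quotient
being defined, that is, with `f'(z) ≠ 0`). -/
noncomputable def radiusOfConvexity (β : ℝ) (f : ℂ → ℂ) : ℝ :=
  sSup {r : ℝ | 0 < r ∧ DifferentiableOn ℂ f (Metric.ball 0 r) ∧
    ∀ z ∈ Metric.ball (0 : ℂ) r,
      deriv f z ≠ 0 ∧ β < (1 + z * deriv (deriv f) z / deriv f z).re}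

/-! With Euler's operator `θ = X d/dX`, both normalised functions have the form `f(z) = z φ(z^k)`,
where `φ(w) = ∑ (-1)^n c_n w^n`, `c_n = Q(ν+2n)/Q(ν) / (4^n n! (ν+1)_n)`, and `k = 2` for `g`, `k =
1` for `h`. Hence `f'` and `(z f')'` are `(1 + kθ)φ` and `(1 + kθ)²φ` at `w = z^k`, and `1 + z
f''/f'` is their quotient. The radius of convexity is `R^(1/k)`, where `R` is the first zero of `(1
+ kθ)²φ`: for `|w| < R` the quotient has positive real part, and at `R` it cannot
(`radiusOfConvexity_eq`).

The zeros are reached through polynomials. Laguerre polynomials in `w/(4m)` tend to the Bessel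
series, and their zeros remain positive after weighting by `Q(ν+2n)` and after each `1 + κθ`
(`IsPosProd.exists_bessel_approx`). The mechanism is that `zP'/P` has negative imaginary part in the
upper half plane for nonconstant `P = ∏(1 - yX)`, `y > 0`.

If `y` is a limit of the largest reciprocal zeros and `S_j` is the limit of the `j`-th power sums,
then `y^j ≤ S_j` and `S_(j+1) ≤ y S_j`. Newton's identities express `S_1, S_2, S_3` by the
coefficients, and `R = 1/y`; this gives the four bounds. Their strictness comes from
`factorPoly.not_geometric`. Bounds uniform in the degree (`factorPoly.estimates_of_euler`) carry
nonvanishing and positivity to the limit, so no factorization of the entire functions is needed. -/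

open Polynomial in
/-- A real polynomial which is a product of factors `1 - y X` with `y > 0`. -/
def IsPosProd (P : ℝ[X]) : Prop :=
  ∃ s : Multiset ℝ, (∀ y ∈ s, 0 < y) ∧ P = (s.map fun y => 1 - C y * X).prod

/-! ### Polynomials with only positive zeros, and operators preserving them. -/

namespace IsPosProd

open Polynomial

lemma aeval_coe (P : ℝ[X]) (x : ℝ) : aeval (x : ℂ) P = ((P.eval x : ℝ) : ℂ) := by
  simpa using aeval_algebraMap_apply ℂ x P

lemma coeff_zero {P : ℝ[X]} (h : IsPosProd P) : P.coeff 0 = 1 := by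
  obtain ⟨s, -, rfl⟩ := h
  rw [coeff_zero_eq_eval_zero, eval_multiset_prod, Multiset.map_map]
  simp

lemma alternating {P : ℝ[X]} (h : IsPosProd P) (n : ℕ) : 0 ≤ (-1) ^ n * P.coeff n := by
  obtain ⟨s, hs, rfl⟩ := h
  induction s using Multiset.induction_on generalizing n with
  | empty => rcases n with _ | n <;> simp [coeff_one]
  | cons y s ih =>
    have hy : 0 < y := hs y (by simp)
    have ih := fun n => ih n (fun x hx => hs x (by simp [hx]))
    rw [Multiset.map_cons, Multiset.prod_cons, sub_mul, one_mul, mul_assoc, coeff_sub, coeff_C_mul]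
    rcases n with _ | n
    · simpa using ih 0
    · rw [coeff_X_mul]
      have h1 := ih (n + 1)
      have h2 := mul_nonneg hy.le (ih n)
      rw [pow_succ] at *
      linarith

/-- Data on the logarithmic derivative in the upper half plane. -/
lemma im_logDeriv {s : Multiset ℝ} (hs : ∀ y ∈ s, 0 < y) {z : ℂ} (hz : 0 < z.im) :
    aeval z (s.map fun y => 1 - C y * X).prod ≠ 0 ∧
    (z * aeval z (derivative (s.map fun y => 1 - C y * X).prod)
      / aeval z (s.map fun y => 1 - C y * X).prod).im ≤ 0 ∧
    (s ≠ 0 → (z * aeval z (derivative (s.map fun y => 1 - C y * X).prod)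
      / aeval z (s.map fun y => 1 - C y * X).prod).im < 0) := by
  induction s using Multiset.induction_on with
  | empty => simp
  | cons y s ih =>
    have hy : 0 < y := hs y (by simp)
    obtain ⟨h0, h1, -⟩ := ih (fun x hx => hs x (by simp [hx]))
    rw [Multiset.map_cons, Multiset.prod_cons]
    set P := (s.map fun y => 1 - C y * X).prod
    have hne : (1 - (y : ℂ) * z) ≠ 0 := by
      intro h
      have := congrArg Complex.im h
      simp at this
      rcases this with h | h <;> linarith
    have e : aeval z (1 - C y * X : ℝ[X]) = 1 - (y : ℂ) * z := by simp
    have e' : aeval z (derivative (1 - C y * X : ℝ[X])) = -(y : ℂ) := by simp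
    -- A factor `1 - yX` contributes `-yz/(1 - yz)`, with imaginary part `-y Im z / |1 - yz|²`.
    have key : (z * aeval z (derivative ((1 - C y * X) * P)) / aeval z ((1 - C y * X) * P)).im < 0 := by
      have : z * aeval z (derivative ((1 - C y * X) * P)) / aeval z ((1 - C y * X) * P)
          = (-(y : ℂ) * z) / (1 - (y : ℂ) * z) + z * aeval z (derivative P) / aeval z P := by
        rw [derivative_mul, map_add, map_mul, map_mul, map_mul, e, e']
        rw [div_add_div _ _ hne h0, div_eq_div_iff (mul_ne_zero hne h0) (mul_ne_zero hne h0)]; ring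
      rw [this, Complex.add_im, Complex.div_im]
      have hn : 0 < Complex.normSq (1 - (y : ℂ) * z) := Complex.normSq_pos.mpr hne
      have : 0 < y * z.im / Complex.normSq (1 - (y : ℂ) * z) := by positivity
      have e4 : ∀ n : ℝ, -(y * z.im * (1 - y * z.re)) / n - y * z.re * (y * z.im) / n
          = -(y * z.im / n) := fun n => by ring
      simp at this ⊢
      rw [e4]
      linarith
    refine ⟨?_, key.le, fun _ => key⟩
    rw [map_mul, e]
    exact mul_ne_zero hne h0

lemma of_pos_roots (n : ℕ) : ∀ P : ℝ[X], P.natDegree = n → P.coeff 0 = 1 →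
    (∀ z : ℂ, aeval z P = 0 → ∃ x : ℝ, 0 < x ∧ z = x) → IsPosProd P := by
  induction n with
  | zero =>
    intro P hd h0 _
    refine ⟨0, by simp, ?_⟩
    rw [eq_C_of_natDegree_eq_zero hd, h0]; simp
  | succ n ih =>
    intro P hd h0 hP
    obtain ⟨z, hz⟩ := IsAlgClosed.exists_aeval_eq_zero ℂ P
      (by rw [degree_eq_natDegree (by rintro rfl; simp at h0), hd]; exact_mod_cast Nat.succ_ne_zero n)
    obtain ⟨x, hx, rfl⟩ := hP z hz
    have hr : P.IsRoot x := by
      have : ((P.eval x : ℝ) : ℂ) = 0 := by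
        rw [← hz, aeval_coe]
      exact_mod_cast this
    obtain ⟨T, rfl⟩ := dvd_iff_isRoot.mpr hr
    have hT0 : T ≠ 0 := by rintro rfl; simp at h0
    have hfac : (X - C x) * T = (1 - C x⁻¹ * X) * (C (-x) * T) := by
      have : (X - C x : ℝ[X]) = (1 - C x⁻¹ * X) * C (-x) := by
        have : (C x⁻¹ * C x : ℝ[X]) = 1 := by rw [← C_mul, inv_mul_cancel₀ hx.ne', C_1]
        rw [C_neg]
        linear_combination (-X) * this
      rw [this, mul_assoc]
    obtain ⟨s, hs, hsP⟩ := ih (C (-x) * T) (by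
        rw [natDegree_C_mul (by linarith)]
        rw [natDegree_mul (X_sub_C_ne_zero x) hT0, natDegree_X_sub_C] at hd
        omega) (by
        rw [hfac, mul_coeff_zero] at h0
        simpa using h0) (by
        intro z hz
        refine hP z ?_
        rw [hfac, map_mul, hz, mul_zero])
    refine ⟨x⁻¹ ::ₘ s, ?_, ?_⟩
    · intro y hy
      rcases Multiset.mem_cons.mp hy with rfl | hy
      · positivity
      · exact hs y hy
    · rw [Multiset.map_cons, Multiset.prod_cons, ← hsP, hfac]

/-- Conjugation excludes zeros in the lower half plane as well, and alternating signs with constant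
term `1` make `P ≥ 1` on the non-positive axis. Only the upper half plane then has to be checked for
each operator. -/
lemma of_alternating {P : ℝ[X]} (h0 : P.coeff 0 = 1) (ha : ∀ n, 0 ≤ (-1) ^ n * P.coeff n)
    (hP : ∀ z : ℂ, 0 < z.im → aeval z P ≠ 0) : IsPosProd P := by
  refine of_pos_roots _ P rfl h0 ?_
  intro z hz
  have him : z.im = 0 := by
    rcases lt_trichotomy z.im 0 with h | h | h
    · refine absurd ?_ (hP (starRingEnd ℂ z) (by simpa using h))
      have := Polynomial.aeval_conj P z
      rw [this, hz, map_zero]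
    · exact h
    · exact absurd hz (hP z h)
  refine ⟨z.re, ?_, by apply Complex.ext <;> simp [him]⟩
  have hz' : z = (z.re : ℂ) := by apply Complex.ext <;> simp [him]
  by_contra hle
  push Not at hle
  have hev : P.eval z.re = 0 := by
    have : ((P.eval z.re : ℝ) : ℂ) = 0 := by
      rw [← aeval_coe, ← hz', hz]
    exact_mod_cast this
  rw [eval_eq_sum_range, Finset.sum_range_succ'] at hev
  have : 0 ≤ ∑ k ∈ Finset.range P.natDegree, P.coeff (k + 1) * z.re ^ (k + 1) := by
    refine Finset.sum_nonneg fun k _ => ?_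
    have h1 : 0 ≤ (-z.re) ^ (k + 1) := pow_nonneg (by linarith) _
    have h2 := mul_nonneg (ha (k + 1)) h1
    rw [neg_pow] at h2
    have h3 : ((-1 : ℝ) ^ (k + 1)) * (-1) ^ (k + 1) = 1 := by rw [← mul_pow]; simp
    calc 0 ≤ _ := h2
      _ = ((-1 : ℝ) ^ (k + 1) * (-1) ^ (k + 1)) * (P.coeff (k + 1) * z.re ^ (k + 1)) := by ring
      _ = _ := by rw [h3, one_mul]
  rw [h0] at hev
  simp at hev
  linarith

lemma coeff_X_mul_derivative (P : ℝ[X]) (n : ℕ) : (X * derivative P).coeff n = n * P.coeff n := by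
  rcases n with _ | n
  · simp
  · rw [coeff_X_mul, coeff_derivative]; push_cast; ring

/-- The Euler operator `1 + κ X d/dX` preserves `IsPosProd`. -/
lemma euler {P : ℝ[X]} (h : IsPosProd P) {κ : ℝ} (hκ : 0 ≤ κ) :
    IsPosProd (P + C κ * (X * derivative P)) := by
  have hc : ∀ n, (P + C κ * (X * derivative P)).coeff n = (1 + κ * n) * P.coeff n := by
    intro n; rw [coeff_add, coeff_C_mul, coeff_X_mul_derivative]; ring
  refine of_alternating (by rw [hc, h.coeff_zero]; simp) ?_ ?_
  · intro n
    rw [hc, mul_left_comm]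
    exact mul_nonneg (by positivity) (h.alternating n)
  · intro z hz
    obtain ⟨s, hs, rfl⟩ := h
    obtain ⟨h0, h1, h2⟩ := im_logDeriv hs hz
    set P := (s.map fun y => 1 - C y * X).prod with hPdef
    intro hzero
    rw [map_add, map_mul, map_mul, aeval_X, aeval_C] at hzero
    by_cases hs0 : s = 0
    · subst hs0
      simp [hPdef] at hzero
    rcases hκ.eq_or_lt with rfl | hκ
    · simp at hzero; exact h0 hzero
    -- A zero would give the logarithmic derivative a real value, against its strictly negative
    -- imaginary part.
    have : z * aeval z (derivative P) / aeval z P = ((-κ⁻¹ : ℝ) : ℂ) := by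
      have hκ' : (κ : ℂ) ≠ 0 := by exact_mod_cast hκ.ne'
      simp only [Complex.coe_algebraMap] at hzero
      rw [div_eq_iff h0]
      push_cast
      field_simp
      linear_combination hzero
    have h3 := h2 hs0
    rw [this, Complex.ofReal_im] at h3
    exact lt_irrefl _ h3

/-- The raising operator of the Laguerre polynomials preserves `IsPosProd`. -/
lemma raise {P : ℝ[X]} (h : IsPosProd P) {α : ℝ} (hα : 0 < α) :
    IsPosProd (P + C α⁻¹ * (X * derivative P - X * P)) := by
  refine of_alternating (by simp [h.coeff_zero]) ?_ ?_
  · intro n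
    rw [coeff_add, coeff_C_mul, coeff_sub, coeff_X_mul_derivative]
    rcases n with _ | n
    · simp [h.coeff_zero]
    · rw [coeff_X_mul]
      have e : (-1 : ℝ) ^ (n + 1) *
          (P.coeff (n + 1) + α⁻¹ * (((n + 1 : ℕ) : ℝ) * P.coeff (n + 1) - P.coeff n))
          = (1 + α⁻¹ * ((n + 1 : ℕ) : ℝ)) * ((-1) ^ (n + 1) * P.coeff (n + 1))
            + α⁻¹ * ((-1) ^ n * P.coeff n) := by ring
      rw [e]
      have h1 := h.alternating (n + 1)
      have h2 := h.alternating n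
      positivity
  · intro z hz
    obtain ⟨s, hs, rfl⟩ := h
    obtain ⟨h0, h1, -⟩ := im_logDeriv hs hz
    set P := (s.map fun y => 1 - C y * X).prod with hPdef
    intro hzero
    simp only [map_add, map_mul, map_sub, aeval_X, aeval_C, Complex.coe_algebraMap] at hzero
    -- Here a zero would give the logarithmic derivative the imaginary part `Im z > 0`.
    have : z * aeval z (derivative P) / aeval z P = z - (α : ℂ) := by
      have hκ' : (α : ℂ) ≠ 0 := by exact_mod_cast hα.ne'
      rw [div_eq_iff h0]
      push_cast at hzero
      field_simp at hzero
      linear_combination hzero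
    rw [this] at h1
    simp at h1
    linarith

lemma scale {P : ℝ[X]} (h : IsPosProd P) {t : ℝ} (ht : 0 < t) : IsPosProd (P.comp (C t * X)) := by
  obtain ⟨s, hs, rfl⟩ := h
  refine ⟨s.map fun y => y * t, ?_, ?_⟩
  · intro y hy
    obtain ⟨x, hx, rfl⟩ := Multiset.mem_map.mp hy
    exact mul_pos (hs x hx) ht
  · rw [multiset_prod_comp, Multiset.map_map, Multiset.map_map]
    congr 1
    refine Multiset.map_congr rfl fun y _ => ?_
    simp [mul_assoc]

end IsPosProd

/-! ### Laguerre polynomials with quadratic weights. -/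

/-- The rising factorial `x (x + 1) ⋯ (x + n - 1)`. -/
def risingFact (x : ℝ) (n : ℕ) : ℝ := ∏ i ∈ Finset.range n, (x + i)

lemma risingFact_zero (x : ℝ) : risingFact x 0 = 1 := by simp [risingFact]

lemma risingFact_succ (x : ℝ) (n : ℕ) : risingFact x (n + 1) = risingFact x n * (x + n) :=
  Finset.prod_range_succ _ _

lemma risingFact_succ' (x : ℝ) (n : ℕ) : risingFact x (n + 1) = x * risingFact (x + 1) n := by
  unfold risingFact
  rw [Finset.prod_range_succ', mul_comm]
  simp only [Nat.cast_zero, add_zero]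
  congr 1
  refine Finset.prod_congr rfl fun i _ => ?_
  push_cast; ring

lemma risingFact_pos {x : ℝ} (hx : 0 < x) (n : ℕ) : 0 < risingFact x n :=
  Finset.prod_pos fun i _ => by positivity

/-- A quadratic with real zeros, none of which lies on the non-negative half line. -/
lemma nonneg_of_no_zero {A B : ℝ} (hd : 0 ≤ B ^ 2 - 4 * A)
    (hno : ∀ t : ℝ, 0 ≤ t → 1 + B * t + A * t ^ 2 ≠ 0) : 0 ≤ A ∧ 0 ≤ B := by
  have hA : 0 ≤ A := by
    by_contra hA
    push Not at hA
    have hs := Real.sq_sqrt hd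
    have h1 : |B| < √(B ^ 2 - 4 * A) := by
      rw [← Real.sqrt_sq_eq_abs]; exact Real.sqrt_lt_sqrt (by positivity) (by linarith)
    refine hno ((-B - √(B ^ 2 - 4 * A)) / (2 * A)) ?_ ?_
    · apply div_nonneg_of_nonpos <;> linarith [neg_abs_le B]
    · field_simp [hA.ne]; linear_combination hs
  have hB0 : 0 ≤ B := by
    by_contra hB0
    push Not at hB0
    have hs := Real.sq_sqrt hd
    rcases hA.eq_or_lt with h | h
    · rw [← h] at hno
      refine hno (-B⁻¹) (by simpa using hB0.le) ?_
      field_simp [hB0.ne]; ring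
    · refine hno ((-B + √(B ^ 2 - 4 * A)) / (2 * A)) ?_ ?_
      · have := Real.sqrt_nonneg (B ^ 2 - 4 * A)
        apply div_nonneg <;> linarith
      · field_simp; linear_combination hs
  exact ⟨hA, hB0⟩

namespace IsPosProd

open Polynomial

/-- Laguerre polynomials, normalised at `0`, have only positive zeros. -/
lemma exists_laguerre (m : ℕ) : ∀ {x : ℝ}, 0 < x →
    ∃ P : ℝ[X], IsPosProd P ∧ ∀ n, P.coeff n = (-1) ^ n * (m.choose n : ℝ) / risingFact x n := by
  induction m with
  | zero =>
    intro x hx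
    refine ⟨1, ⟨0, by simp, by simp⟩, fun n => ?_⟩
    rcases n with _ | n <;> simp [coeff_one, risingFact_zero]
  | succ m ih =>
    intro x hx
    obtain ⟨P, hP, hc⟩ := ih (x := x + 1) (by linarith)
    -- Raising with `α = x` takes degree `m` and parameter `x + 1` to degree `m + 1` and parameter
    -- `x`.
    refine ⟨_, hP.raise hx, fun n => ?_⟩
    rw [coeff_add, coeff_C_mul, coeff_sub, coeff_X_mul_derivative]
    rcases n with _ | n
    · simp [hP.coeff_zero, risingFact_zero]
    · rw [coeff_X_mul, hc, hc, Nat.choose_succ_succ', risingFact_succ, risingFact_succ' x n]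
      have h1 := (risingFact_pos (x := x + 1) (by linarith) n).ne'
      have h2 : x + 1 + n ≠ 0 := by positivity
      push_cast
      field_simp
      ring

/-- Multiplying the coefficients of Laguerre polynomials by a quadratic without zeros on the
non-negative half line preserves the positivity of the zeros. -/
lemma exists_laguerre_mul {x A γ : ℝ} (hx : 0 < x)
    (hno : ∀ t : ℝ, 0 ≤ t → 1 + (γ + A * (x - 1)) * t + A * t ^ 2 ≠ 0)
    (hdisc : (γ + A * (x - 1)) ^ 2 - 4 * A < 0 → 0 ≤ γ ∧ 0 < A) (m : ℕ) :
    ∃ P : ℝ[X], IsPosProd P ∧ ∀ n, P.coeff n = (-1) ^ n * (m.choose n : ℝ) / risingFact x n *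
      (1 + (γ + A * (x - 1)) * n + A * (n : ℝ) ^ 2) := by
  obtain ⟨P, hP, hc⟩ := exists_laguerre m hx
  have hpos : ∀ t : ℝ, 0 ≤ t → 0 < 1 + (γ + A * (x - 1)) * t + A * t ^ 2 := by
    intro t ht
    by_contra hle
    push Not at hle
    have hcont : ContinuousOn (fun t : ℝ => 1 + (γ + A * (x - 1)) * t + A * t ^ 2) (Set.Icc 0 t) := by
      fun_prop
    obtain ⟨u, hu, hu0⟩ := intermediate_value_Icc' ht hcont (show (0 : ℝ) ∈ Set.Icc _ _ from
      ⟨hle, by norm_num⟩)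
    exact hno u hu.1 hu0
  rcases lt_or_ge ((γ + A * (x - 1)) ^ 2 - 4 * A) 0 with hd | hd
  · obtain ⟨hγ, hA⟩ := hdisc hd
    -- The weight is `1 + γθ + Aθ(θ + x - 1)`. The Laguerre equation `θ(θ + x - 1)P = X(θ - m)P`
    -- reduces it to a first-order operator, to which the half-plane argument applies.
    have hWc : ∀ n, (P + C γ * (X * derivative P)
        - C A * (X * (C (m : ℝ) * P - X * derivative P))).coeff n
        = (-1) ^ n * (m.choose n : ℝ) / risingFact x n *
          (1 + (γ + A * (x - 1)) * n + A * (n : ℝ) ^ 2) := by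
      intro n
      rw [coeff_sub, coeff_add, coeff_C_mul, coeff_C_mul, coeff_X_mul_derivative]
      rcases n with _ | n
      · simp [hP.coeff_zero, risingFact_zero]
      · rw [coeff_X_mul, coeff_sub, coeff_C_mul, coeff_X_mul_derivative, hc, hc, risingFact_succ]
        have h1 := (risingFact_pos hx n).ne'
        have h2 : x + n ≠ 0 := by positivity
        have h3 : ((m.choose (n + 1) : ℕ) : ℝ) * (n + 1) = m.choose n * (m - n) := by
          rcases le_or_gt n m with h | h
          · have := Nat.choose_succ_right_eq m n
            rw [← Nat.cast_sub h]
            exact_mod_cast this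
          · simp [Nat.choose_eq_zero_of_lt h, Nat.choose_eq_zero_of_lt (h.trans n.lt_succ_self)]
        push_cast
        field_simp
        rw [pow_succ]
        linear_combination ((-1) ^ n * A * (x + n)) * h3
    refine ⟨_, of_alternating (by rw [hWc]; simp [risingFact_zero]) ?_ ?_, hWc⟩
    · intro n
      rw [hWc]
      have h1 := risingFact_pos hx n
      have h2 := (hpos n n.cast_nonneg).le
      have h3 : ((-1 : ℝ) ^ n) * (-1) ^ n = 1 := by rw [← mul_pow]; simp
      calc (0 : ℝ) ≤ (m.choose n : ℝ) / risingFact x n *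
            (1 + (γ + A * (x - 1)) * n + A * (n : ℝ) ^ 2) := mul_nonneg (by positivity) h2
        _ = ((-1 : ℝ) ^ n * (-1) ^ n) * ((m.choose n : ℝ) / risingFact x n *
            (1 + (γ + A * (x - 1)) * n + A * (n : ℝ) ^ 2)) := by rw [h3, one_mul]
        _ = _ := by ring
    · intro z hz
      obtain ⟨s, hs, rfl⟩ := hP
      obtain ⟨h0, h1, -⟩ := im_logDeriv hs hz
      set P := (s.map fun y => 1 - C y * X).prod with hPdef
      intro hzero
      simp only [map_add, map_mul, map_sub, aeval_X, aeval_C, Complex.coe_algebraMap] at hzero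
      have hden : (γ + A * z : ℂ) ≠ 0 := by
        intro h
        have := congrArg Complex.im h
        simp at this
        rcases this with h | h <;> linarith
      -- The imaginary part of the right side is `A Im z (mγ + 1)/|γ + Az|²`, which is positive.
      have : z * aeval z (derivative P) / aeval z P = (A * m * z - 1) / (γ + A * z) := by
        rw [div_eq_div_iff h0 hden]
        push_cast at hzero
        linear_combination hzero
      rw [this, Complex.div_im] at h1
      have hn : 0 < Complex.normSq (γ + A * z) := Complex.normSq_pos.mpr hden
      have : 0 < A * z.im * (m * γ + 1) / Complex.normSq (γ + A * z) := by positivity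
      have e4 : ∀ n : ℝ, A * m * z.im * (γ + A * z.re) / n - (A * m * z.re - 1) * (A * z.im) / n
          = A * z.im * (m * γ + 1) / n := fun n => by ring
      simp at h1 this
      rw [← tsub_nonpos, e4] at h1
      linarith
  · obtain ⟨B, hB⟩ : ∃ B, B = γ + A * (x - 1) := ⟨_, rfl⟩
    rw [← hB] at hd
    simp only [← hB] at hno ⊢
    obtain ⟨hA, hB0⟩ := nonneg_of_no_zero hd hno
    have hs := Real.sq_sqrt hd
    have hle : √(B ^ 2 - 4 * A) ≤ B := Real.sqrt_le_iff.mpr ⟨hB0, by linarith⟩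
    have hnn := Real.sqrt_nonneg (B ^ 2 - 4 * A)
    set r := √(B ^ 2 - 4 * A)
    -- With real zeros the weight splits as `(1 + κ₁n)(1 + κ₂n)`, that is, into two Euler operators
    -- with `κ₁, κ₂ ≥ 0`.
    refine ⟨_, (hP.euler (κ := (B + r) / 2) (by linarith)).euler (κ := (B - r) / 2) (by linarith), ?_⟩
    intro n
    simp only [coeff_add, coeff_C_mul, coeff_X_mul_derivative, hc]
    linear_combination (-(-1 : ℝ) ^ n * (m.choose n : ℝ) / risingFact x n * n ^ 2 / 4) * hs

/-- The rescaled and weighted Laguerre polynomials which approximate the weighted Bessel series. -/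
lemma exists_bessel_approx {x A γ κ : ℝ} (hx : 0 < x) (hκ : 0 ≤ κ)
    (hno : ∀ t : ℝ, 0 ≤ t → 1 + (γ + A * (x - 1)) * t + A * t ^ 2 ≠ 0)
    (hdisc : (γ + A * (x - 1)) ^ 2 - 4 * A < 0 → 0 ≤ γ ∧ 0 < A) {m : ℕ} (hm : 0 < m) :
    ∃ P : ℝ[X], IsPosProd P ∧ ∀ n, P.coeff n = (-1) ^ n * ((1 + κ * n) *
      ((1 + (γ + A * (x - 1)) * n + A * (n : ℝ) ^ 2) / (4 ^ n * n.factorial * risingFact x n))) *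
        (m.descFactorial n / (m : ℝ) ^ n) := by
  obtain ⟨P, hP, hc⟩ := exists_laguerre_mul hx hno hdisc m
  have hm' : (0 : ℝ) < m := by exact_mod_cast hm
  -- The scale `1/(4m)` turns `m.choose n` into `1/(4^n n!)` times a factor tending to `1`.
  refine ⟨_, (hP.scale (t := (4 * (m : ℝ))⁻¹) (by positivity)).euler hκ, fun n => ?_⟩
  rw [coeff_add, coeff_C_mul, coeff_X_mul_derivative, comp_C_mul_X_coeff, hc,
    Nat.descFactorial_eq_factorial_mul_choose]
  have h1 := (risingFact_pos hx n).ne'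
  push_cast
  rw [inv_pow, mul_pow]
  field_simp

end IsPosProd

/-! ### Reciprocal zeros: power sums and the effect of the Euler operator. -/

/-- The polynomial with constant term `1` and the reciprocals of the elements of `s` as zeros. -/
noncomputable def factorPoly (s : Multiset ℝ) : Polynomial ℝ :=
  (s.map fun y => 1 - Polynomial.C y * Polynomial.X).prod

namespace factorPoly

open Polynomial

lemma cons (y : ℝ) (s : Multiset ℝ) : factorPoly (y ::ₘ s) = (1 - C y * X) * factorPoly s := by
  simp [factorPoly]

lemma aeval_eq {K : Type*} [Field K] [Algebra ℝ K] (s : Multiset ℝ) (w : K) :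
    aeval w (factorPoly s) = (s.map fun y => 1 - algebraMap ℝ K y * w).prod := by
  induction s using Multiset.induction_on with
  | empty => simp [factorPoly]
  | cons y s ih => simp [cons, ih]

lemma aeval_derivative {K : Type*} [Field K] [Algebra ℝ K] (s : Multiset ℝ) (w : K)
    (h : ∀ y ∈ s, 1 - algebraMap ℝ K y * w ≠ 0) :
    w * aeval w (derivative (factorPoly s)) = -(aeval w (factorPoly s) *
      (s.map fun y => algebraMap ℝ K y * w / (1 - algebraMap ℝ K y * w)).sum) := by
  induction s using Multiset.induction_on with
  | empty => simp [factorPoly]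
  | cons y s ih =>
    have ih := ih (fun x hx => h x (by simp [hx]))
    have hy := h y (by simp)
    have e : algebraMap ℝ K y * w / (1 - algebraMap ℝ K y * w) * (1 - algebraMap ℝ K y * w)
        = algebraMap ℝ K y * w := div_mul_cancel₀ _ hy
    rw [cons, derivative_mul, Multiset.map_cons, Multiset.sum_cons]
    simp only [map_add, map_mul, map_sub, map_one, derivative_one, derivative_C_mul,
      derivative_X, aeval_X, aeval_C, mul_one, zero_sub, map_neg]
    linear_combination (1 - algebraMap ℝ K y * w) * ih + (aeval w (factorPoly s)) * e

lemma eval_pos {s : Multiset ℝ} {x : ℝ} (h : ∀ y ∈ s, y * x < 1) : 0 < aeval x (factorPoly s) := by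
  rw [aeval_eq]
  refine Multiset.prod_induction (0 < ·) _ (fun a b ha hb => mul_pos ha hb) one_pos ?_
  intro a ha
  obtain ⟨y, hy, rfl⟩ := Multiset.mem_map.mp ha
  have := h y hy
  simp only [Algebra.algebraMap_self, RingHom.id_apply]
  linarith

/-- The power sums of `s`. -/
noncomputable def psum (s : Multiset ℝ) (k : ℕ) : ℝ := (s.map fun y => y ^ k).sum

/-- Newton's identities. -/
lemma newton (s : Multiset ℝ) (n : ℕ) : ((n : ℝ) + 1) * (factorPoly s).coeff (n + 1) =
    -∑ j ∈ Finset.range (n + 1), (factorPoly s).coeff (n - j) * psum s (j + 1) := by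
  -- The generating function of the power sums is `-P'/P`, cleared of its denominator.
  have key : (derivative (factorPoly s) : PowerSeries ℝ) =
      -((factorPoly s : PowerSeries ℝ) * PowerSeries.mk fun j => psum s (j + 1)) := by
    induction s using Multiset.induction_on with
    | empty =>
      have : (PowerSeries.mk fun j => psum (0 : Multiset ℝ) (j + 1)) = 0 := by
        ext; simp [psum]
      simp [factorPoly, this]
    | cons y s ih =>
      have e1 : (PowerSeries.mk fun j => psum (y ::ₘ s) (j + 1)) =
          (PowerSeries.mk fun j => y ^ (j + 1)) + PowerSeries.mk fun j => psum s (j + 1) := by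
        ext; simp [psum]
      have e2 : ((1 : PowerSeries ℝ) - PowerSeries.C y * PowerSeries.X) *
          (PowerSeries.mk fun j => y ^ (j + 1)) = PowerSeries.C y := by
        ext n
        rw [sub_mul, one_mul, mul_assoc, map_sub, PowerSeries.coeff_C_mul]
        rcases n with _ | n
        · simp
        · rw [PowerSeries.coeff_succ_X_mul, PowerSeries.coeff_mk, PowerSeries.coeff_mk,
            PowerSeries.coeff_C]
          simp [pow_succ]; ring
      rw [e1, cons, derivative_mul]
      simp only [derivative_sub, derivative_one, derivative_C_mul, derivative_X, mul_one, zero_sub,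
        Polynomial.coe_add, Polynomial.coe_mul, Polynomial.coe_neg, Polynomial.coe_sub,
        Polynomial.coe_one, Polynomial.coe_C, Polynomial.coe_X]
      rw [ih]
      linear_combination (factorPoly s : PowerSeries ℝ) * e2
  have h := congrArg (PowerSeries.coeff n) key
  rw [Polynomial.coeff_coe, coeff_derivative, map_neg, PowerSeries.coeff_mul,
    Finset.Nat.sum_antidiagonal_eq_sum_range_succ_mk, ← Finset.sum_range_reflect] at h
  rw [mul_comm, h]
  congr 1
  refine Finset.sum_congr rfl fun j hj => ?_
  have hj' : j ≤ n := Nat.lt_succ_iff.mp (Finset.mem_range.mp hj)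
  simp only [Polynomial.coeff_coe, PowerSeries.coeff_mk]
  have e1 : n + 1 - 1 - j = n - j := by omega
  have e2 : n - (n + 1 - 1 - j) = j := by omega
  rw [e2, e1]

lemma le_psum {s : Multiset ℝ} (hs : ∀ y ∈ s, 0 < y) {Y : ℝ} (hY : Y ∈ s) (k : ℕ) :
    Y ^ k ≤ psum s k := by
  refine Multiset.single_le_sum ?_ _ (Multiset.mem_map_of_mem _ hY)
  intro x hx
  obtain ⟨y, hy, rfl⟩ := Multiset.mem_map.mp hx
  exact pow_nonneg (hs y hy).le _

lemma psum_succ_le {s : Multiset ℝ} (hs : ∀ y ∈ s, 0 < y) {Y : ℝ} (hY : ∀ y ∈ s, y ≤ Y) (k : ℕ) :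
    psum s (k + 1) ≤ Y * psum s k := by
  unfold psum
  rw [← Multiset.sum_map_mul_left]
  refine Multiset.sum_map_le_sum_map _ _ fun y hy => ?_
  rw [pow_succ']
  exact mul_le_mul_of_nonneg_right (hY y hy) (pow_nonneg (hs y hy).le _)

/-- This sums `y^k (Y - y)² ≥ 0`. It propagates an equality `S_(k+2) = Y S_(k+1)` to all later
indices. -/
lemma psum_convex {s : Multiset ℝ} (hs : ∀ y ∈ s, 0 < y) (Y : ℝ) (k : ℕ) :
    2 * Y * psum s (k + 1) ≤ Y ^ 2 * psum s k + psum s (k + 2) := by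
  unfold psum
  rw [← Multiset.sum_map_mul_left, ← Multiset.sum_map_mul_left, ← Multiset.sum_map_add]
  refine Multiset.sum_map_le_sum_map _ _ fun y hy => ?_
  have := mul_nonneg (pow_nonneg (hs y hy).le k) (sq_nonneg (Y - y))
  rw [pow_succ y k, pow_add y k 2]
  linarith

/-- If `(1 + κ X d/dX) ∏ (1 - s X) = ∏ (1 - y X)`, then every `s` is less than the largest `y`. -/
lemma lt_of_euler {s t : Multiset ℝ} (hs : ∀ y ∈ s, 0 < y) (ht : ∀ y ∈ t, 0 < y) {κ : ℝ}
    (hκ : 0 < κ) (h : factorPoly s + C κ * (X * derivative (factorPoly s)) = factorPoly t)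
    {Y : ℝ} (hY : Y ∈ t) (hmax : ∀ y ∈ t, y ≤ Y) :
    (∀ y ∈ s, y < Y) ∧ κ * (s.map fun y => y * Y⁻¹ / (1 - y * Y⁻¹)).sum = 1 := by
  have hY0 := ht Y hY
  have hform : ∀ x : ℝ, (∀ y ∈ s, y * x < 1) → aeval x (factorPoly t) =
      aeval x (factorPoly s) * (1 - κ * (s.map fun y => y * x / (1 - y * x)).sum) := by
    intro x hx
    have := aeval_derivative s x (fun y hy => by
      have := hx y hy
      simp only [Algebra.algebraMap_self, RingHom.id_apply]; linarith)
    rw [← h, map_add, map_mul, map_mul, aeval_X, this, aeval_C]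
    simp only [Algebra.algebraMap_self, RingHom.id_apply]
    ring
  have hlt : ∀ y ∈ s, y < Y := by
    by_contra! hcon
    obtain ⟨y₀, hy₀, hYy₀⟩ := hcon
    obtain ⟨M, hM, hMmax⟩ := s.toFinset.exists_max_image id ⟨y₀, by simpa using hy₀⟩
    simp only [Multiset.mem_toFinset, id] at hM hMmax
    have hM0 := hs M hM
    have hMY : Y ≤ M := hYy₀.trans (hMmax y₀ hy₀)
    -- At this point the term of `M` alone gives `κ Mx/(1 - Mx) = 1`, so the transformed polynomial
    -- is at most `0`; yet all its factors are positive there.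
    set x := ((1 + κ) * M)⁻¹ with hx
    have hx0 : 0 < x := by positivity
    have hMx : M * x = 1 / (1 + κ) := by rw [hx]; field_simp
    have hlt1 : M * x < 1 := by rw [hMx, div_lt_one (by linarith)]; linarith
    have hsx : ∀ y ∈ s, y * x < 1 := fun y hy =>
      (mul_le_mul_of_nonneg_right (hMmax y hy) hx0.le).trans_lt hlt1
    have htx : ∀ y ∈ t, y * x < 1 := fun y hy =>
      (mul_le_mul_of_nonneg_right ((hmax y hy).trans hMY) hx0.le).trans_lt hlt1
    have h1 := hform x hsx
    have h2 := eval_pos hsx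
    have h3 := eval_pos htx
    rw [h1] at h3
    have h4 := pos_of_mul_pos_right h3 h2.le
    have h5 : M * x / (1 - M * x) ≤ (s.map fun y => y * x / (1 - y * x)).sum := by
      refine Multiset.single_le_sum ?_ _ (Multiset.mem_map_of_mem (fun y => y * x / (1 - y * x)) hM)
      intro a ha
      obtain ⟨y, hy, rfl⟩ := Multiset.mem_map.mp ha
      exact div_nonneg (mul_nonneg (hs y hy).le hx0.le) (by linarith [hsx y hy])
    have h6 : κ * (M * x / (1 - M * x)) = 1 := by
      have : 1 + κ ≠ 0 := by positivity
      rw [hMx, one_sub_div this]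
      field_simp
      simp [hκ.ne']
    have h7 := mul_le_mul_of_nonneg_left h5 hκ.le
    linarith
  refine ⟨hlt, ?_⟩
  have hsx : ∀ y ∈ s, y * Y⁻¹ < 1 := fun y hy => by
    rw [← div_eq_mul_inv, div_lt_one hY0]; exact hlt y hy
  have h1 := hform Y⁻¹ hsx
  have h2 := eval_pos hsx
  have h3 : aeval Y⁻¹ (factorPoly t) = 0 := by
    rw [aeval_eq]
    refine Multiset.prod_eq_zero (Multiset.mem_map.mpr ⟨Y, hY, ?_⟩)
    simp [hY0.ne']
  rw [h3] at h1
  have := (mul_eq_zero.mp h1.symm).resolve_left h2.ne'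
  linarith

/-- Estimates in the disk bounded by the first zero of `(1 + κ X d/dX) ∏ (1 - s X)`. -/
lemma estimates_of_euler {s t : Multiset ℝ} (hs : ∀ y ∈ s, 0 < y) (ht : ∀ y ∈ t, 0 < y) {κ : ℝ}
    (hκ : 0 < κ) (h : factorPoly s + C κ * (X * derivative (factorPoly s)) = factorPoly t)
    {Y : ℝ} (hY : Y ∈ t) (hmax : ∀ y ∈ t, y ≤ Y) {w : ℂ} (hw : ‖w‖ * Y < 1) :
    Real.exp (-κ⁻¹) ≤ ‖aeval w (factorPoly s)‖ ∧
      1 - ‖w‖ * Y ≤ (aeval w (factorPoly t) / aeval w (factorPoly s)).re := by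
  have hY0 := ht Y hY
  obtain ⟨hlt, hsum⟩ := lt_of_euler hs ht hκ h hY hmax
  have hb : ∀ y ∈ s, y * ‖w‖ < 1 := fun y hy => by
    have := mul_le_mul_of_nonneg_right (hlt y hy).le (norm_nonneg w)
    linarith
  have hnorm : ∀ y ∈ s, 1 - y * ‖w‖ ≤ ‖1 - (y : ℂ) * w‖ := fun y hy => by
    have := norm_sub_norm_le (1 : ℂ) (y * w)
    simpa [abs_of_pos (hs y hy)] using this
  have hne : ∀ y ∈ s, 1 - algebraMap ℝ ℂ y * w ≠ 0 := fun y hy h0 => by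
    have := hnorm y hy
    simp only [Complex.coe_algebraMap] at h0
    rw [h0, norm_zero] at this
    linarith [hb y hy]
  -- Compare with the value at `1/Y`, where `κ` times the sum is exactly `1`; after division by
  -- `‖w‖` each term increases with `‖w‖`.
  have hterm : ∀ y ∈ s, y * ‖w‖ / (1 - y * ‖w‖) ≤ ‖w‖ * Y * (y * Y⁻¹ / (1 - y * Y⁻¹)) := by
    intro y hy
    have h1 := hs y hy
    have h2 := hlt y hy
    have h3 := hb y hy
    have e : ‖w‖ * Y * (y * Y⁻¹ / (1 - y * Y⁻¹)) = y * ‖w‖ / (1 - y * Y⁻¹) := by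
      field_simp
    rw [e]
    have h4 : ‖w‖ ≤ Y⁻¹ := by exact ((lt_div_iff₀ hY0).mpr hw).le.trans_eq (one_div Y)
    have h5 : y * Y⁻¹ < 1 := by rw [← div_eq_mul_inv, div_lt_one hY0]; exact h2
    have h6 := mul_le_mul_of_nonneg_left h4 h1.le
    exact div_le_div_of_nonneg_left (by positivity) (by linarith) (by linarith)
  have hS : κ * (s.map fun y => y * ‖w‖ / (1 - y * ‖w‖)).sum ≤ ‖w‖ * Y := by
    have := Multiset.sum_map_le_sum_map _ _ hterm
    rw [Multiset.sum_map_mul_left] at this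
    calc _ ≤ κ * (‖w‖ * Y * (s.map fun y => y * Y⁻¹ / (1 - y * Y⁻¹)).sum) :=
          mul_le_mul_of_nonneg_left this hκ.le
      _ = ‖w‖ * Y * (κ * (s.map fun y => y * Y⁻¹ / (1 - y * Y⁻¹)).sum) := by ring
      _ = _ := by rw [hsum, mul_one]
  -- The bound `log(1 - u) ≥ -u/(1 - u)` turns the bounded sum into a lower bound independent of the
  -- degree; this is what excludes zeros of the limit.
  have hP : ∀ u : Multiset ℝ, (∀ y ∈ u, y ∈ s) →
      Real.exp (-(u.map fun y => y * ‖w‖ / (1 - y * ‖w‖)).sum) ≤ ‖aeval w (factorPoly u)‖ := by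
    intro u hu
    induction u using Multiset.induction_on with
    | empty => simp [factorPoly]
    | cons y u ih =>
      have ih := ih (fun x hx => hu x (by simp [hx]))
      have hy := hu y (by simp)
      rw [cons, Multiset.map_cons, Multiset.sum_cons, neg_add, Real.exp_add, map_mul, norm_mul]
      refine mul_le_mul ?_ ih (Real.exp_pos _).le (norm_nonneg _)
      have e : aeval w (1 - C y * X : ℝ[X]) = 1 - (y : ℂ) * w := by simp
      rw [e]
      refine le_trans ?_ (hnorm y hy)
      have h1 : 0 < 1 - y * ‖w‖ := by linarith [hb y hy]
      rw [← Real.le_log_iff_exp_le h1]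
      have := Real.one_sub_inv_le_log_of_pos h1
      refine le_of_eq_of_le ?_ this
      field_simp
      ring
  have hlow := hP s (fun _ h => h)
  have hpos : aeval w (factorPoly s) ≠ 0 := by
    rw [← norm_pos_iff]; exact (Real.exp_pos _).trans_le hlow
  refine ⟨le_trans ?_ hlow, ?_⟩
  · rw [Real.exp_le_exp, neg_le_neg_iff, ← one_div, le_div_iff₀ hκ, mul_comm]
    exact hS.trans hw.le
  · have e : aeval w (factorPoly t) / aeval w (factorPoly s) = 1 - κ *
        (s.map fun y => algebraMap ℝ ℂ y * w / (1 - algebraMap ℝ ℂ y * w)).sum := by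
      rw [div_eq_iff hpos, ← h, map_add, map_mul, map_mul, aeval_X, aeval_derivative s w hne,
        aeval_C]
      simp only [Complex.coe_algebraMap]
      ring
    rw [e, Complex.sub_re, Complex.one_re, Complex.re_ofReal_mul]
    have hre : ∀ u : Multiset ℝ, (∀ y ∈ u, y ∈ s) →
        ((u.map fun y => algebraMap ℝ ℂ y * w / (1 - algebraMap ℝ ℂ y * w)).sum).re ≤
          (u.map fun y => y * ‖w‖ / (1 - y * ‖w‖)).sum := by
      intro u hu
      induction u using Multiset.induction_on with
      | empty => simp
      | cons y u ih =>
        have ih := ih (fun x hx => hu x (by simp [hx]))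
        have hy := hu y (by simp)
        rw [Multiset.map_cons, Multiset.map_cons, Multiset.sum_cons, Multiset.sum_cons,
          Complex.add_re]
        refine add_le_add ?_ ih
        refine (Complex.re_le_norm _).trans ?_
        rw [norm_div, norm_mul]
        simp only [Complex.coe_algebraMap, Complex.norm_real, Real.norm_eq_abs, abs_of_pos (hs y hy)]
        have := hs y hy
        exact div_le_div_of_nonneg_left (by positivity) (by linarith [hb y hy]) (hnorm y hy)
    have := mul_le_mul_of_nonneg_left (hre s fun _ h => h) hκ.le
    linarith

end factorPoly

/-! ### Passage to the limit and strict Euler–Rayleigh inequalities. -/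

open Filter Topology

namespace factorPoly

/-- Newton's identities, with constant coefficient `1`, express each power sum by the coefficients
and the earlier power sums. -/
lemma tendsto_psum {t : ℕ → Multiset ℝ} {a : ℕ → ℝ}
    (h : ∀ n, Tendsto (fun m => (factorPoly (t m)).coeff n) atTop (𝓝 (a n)))
    (h0 : ∀ m, (factorPoly (t m)).coeff 0 = 1) (k : ℕ) :
    ∃ l, Tendsto (fun m => psum (t m) (k + 1)) atTop (𝓝 l) := by
  induction k using Nat.strong_induction_on with
  | _ k ih =>
    have e : (fun m => psum (t m) (k + 1)) = fun m =>
        -(((k : ℝ) + 1) * (factorPoly (t m)).coeff (k + 1)) -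
          ∑ j ∈ Finset.range k, (factorPoly (t m)).coeff (k - j) * psum (t m) (j + 1) := by
      ext m
      rw [newton, Finset.sum_range_succ, Nat.sub_self, h0]
      ring
    choose l hl using ih
    refine ⟨-(((k : ℝ) + 1) * a (k + 1)) -
      ∑ j ∈ (Finset.range k).attach, a (k - j) * l j (Finset.mem_range.mp j.2), ?_⟩
    rw [e]
    refine ((h (k + 1)).const_mul _).neg.sub ?_
    simp_rw [← Finset.sum_attach (Finset.range k)]
    exact tendsto_finsetSum _ fun j _ => (h _).mul (hl j _)

/-- Power sums in geometric progression are impossible for a series of order less than one. -/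
lemma not_geometric {A S : ℕ → ℝ} (hA : ∀ n, 0 < A n) (hA0 : A 0 = 1)
    (hdec : Tendsto (fun n : ℕ => ((n : ℝ) + 1) * A (n + 1) / A n) atTop (𝓝 0))
    (hnewton : ∀ n : ℕ, ((n : ℝ) + 1) * ((-1) ^ (n + 1) * A (n + 1)) =
      -∑ j ∈ Finset.range (n + 1), (-1) ^ (n - j) * A (n - j) * S (j + 1)) {y : ℝ}
    (hgeo : ∀ k, S (k + 3) = y * S (k + 2)) : False := by
  have hS1 : S 1 = A 1 := by
    have := hnewton 0
    simp [hA0] at this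
    linarith
  -- Subtracting `y` times one Newton identity from the next cancels every power sum beyond the
  -- second.
  have hrec : ∀ n : ℕ, ((n : ℝ) + 2) * A (n + 2) =
      (S 1 - y * (n + 1)) * A (n + 1) + (y * S 1 - S 2) * A n := by
    intro n
    have h1 := hnewton n
    have h2 := hnewton (n + 1)
    rw [Finset.sum_range_succ'] at h1 h2
    rw [Finset.sum_range_succ'] at h2
    have e : ∀ j, (-1 : ℝ) ^ (n + 1 - (j + 1 + 1)) * A (n + 1 - (j + 1 + 1)) * S (j + 1 + 1 + 1) =
        y * ((-1) ^ (n - (j + 1)) * A (n - (j + 1)) * S (j + 1 + 1)) := by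
      intro j
      have e1 : n + 1 - (j + 1 + 1) = n - (j + 1) := by omega
      rw [e1, hgeo j]; ring
    simp only [e, ← Finset.mul_sum, zero_add, Nat.sub_zero, Nat.add_sub_cancel] at h1 h2
    set T := ∑ j ∈ Finset.range n, (-1 : ℝ) ^ (n - (j + 1)) * A (n - (j + 1)) * S (j + 1 + 1)
    push_cast at h2
    have h3 : ((-1 : ℝ) ^ n) * (-1) ^ n = 1 := by rw [← mul_pow]; simp
    rw [pow_succ, pow_succ] at h2
    rw [pow_succ] at h1
    have h4 : (-1 : ℝ) ^ n * (((n : ℝ) + 2) * A (n + 2)) = (-1) ^ n *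
        ((S 1 - y * (n + 1)) * A (n + 1) + (y * S 1 - S 2) * A n) := by
      linear_combination h2 - y * h1
    exact mul_left_cancel₀ (by positivity) h4
  have hinv : Tendsto (fun n : ℕ => (1 : ℝ) / ((n : ℝ) + 1)) atTop (𝓝 0) :=
    tendsto_one_div_add_atTop_nhds_zero_nat
  have hdec' := (tendsto_add_atTop_iff_nat (f := fun n : ℕ => ((n : ℝ) + 1) * A (n + 1) / A n) 1).mpr
    hdec
  -- Divide the recurrence by `A n`: every other term tends to `0`. The ratio is then affine in `n`
  -- and tends to `0`, which forces `y = 0` and `S 1 = 0`.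
  have hδ : y * S 1 - S 2 = 0 := by
    have h1 := ((hdec'.mul hdec).mul hinv).sub ((hdec.mul hinv).const_mul (S 1) |>.sub
      (hdec.const_mul y))
    refine tendsto_nhds_unique (tendsto_const_nhds.congr fun n => ?_) (h1.trans (by simp))
    have := hrec n
    have a0 := (hA n).ne'
    have a1 := (hA (n + 1)).ne'
    have a2 : (n : ℝ) + 1 ≠ 0 := by positivity
    push_cast
    field_simp
    linear_combination -this
  have hlin : ∀ n : ℕ, ((((n + 1 : ℕ) : ℝ)) + 1) * A (n + 1 + 1) / A (n + 1) = S 1 - y * (n + 1) := by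
    intro n
    rw [div_eq_iff (hA _).ne']
    have := hrec n
    rw [hδ] at this
    push_cast
    linear_combination this
  have hy : y = 0 := by
    have h1 := hdec'.sub ((tendsto_add_atTop_iff_nat 1).mpr hdec')
    refine tendsto_nhds_unique (tendsto_const_nhds.congr fun n => ?_) (h1.trans (by simp))
    rw [hlin, hlin]; push_cast; ring
  have hS : S 1 = 0 := by
    refine tendsto_nhds_unique (tendsto_const_nhds.congr fun n => ?_) hdec'
    rw [hlin, hy]; ring
  rw [hS1] at hS
  exact (hA 1).ne' hS

/-- Euler–Rayleigh inequalities in the limit. -/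
lemma exists_limit {t : ℕ → Multiset ℝ} (ht : ∀ m, ∀ y ∈ t m, 0 < y) {Y : ℕ → ℝ}
    (hY : ∀ m, Y m ∈ t m) (hmax : ∀ m, ∀ y ∈ t m, y ≤ Y m) {A : ℕ → ℝ} (hA : ∀ n, 0 < A n)
    (hA0 : A 0 = 1) (hdec : Tendsto (fun n : ℕ => ((n : ℝ) + 1) * A (n + 1) / A n) atTop (𝓝 0))
    (h : ∀ n, Tendsto (fun m => (factorPoly (t m)).coeff n) atTop (𝓝 ((-1) ^ n * A n)))
    (h0 : ∀ m, (factorPoly (t m)).coeff 0 = 1) :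
    ∃ y : ℝ, 0 < y ∧ (∃ φ : ℕ → ℕ, StrictMono φ ∧ Tendsto (Y ∘ φ) atTop (𝓝 y)) ∧
      y < A 1 ∧ y ^ 2 < A 1 ^ 2 - 2 * A 2 ∧ A 1 ^ 2 - 2 * A 2 < y * A 1 ∧
      A 1 ^ 3 - 3 * A 1 * A 2 + 3 * A 3 < y * (A 1 ^ 2 - 2 * A 2) ∧
      y ^ 3 ≤ A 1 ^ 3 - 3 * A 1 * A 2 + 3 * A 3 := by
  choose l hl using tendsto_psum h h0
  obtain ⟨S, hS⟩ : ∃ S : ℕ → ℝ, ∀ k, S (k + 1) = l k := ⟨fun k => l (k - 1), fun k => by simp⟩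
  simp_rw [← hS] at hl
  have hnewton : ∀ n : ℕ, ((n : ℝ) + 1) * ((-1) ^ (n + 1) * A (n + 1)) =
      -∑ j ∈ Finset.range (n + 1), (-1) ^ (n - j) * A (n - j) * S (j + 1) := by
    intro n
    refine tendsto_nhds_unique ((h (n + 1)).const_mul _) ?_
    simp_rw [newton]
    exact (tendsto_finsetSum _ fun j _ => (h _).mul (hl j)).neg
  have hS1 : S 1 = A 1 := by
    have := hnewton 0
    simp [hA0] at this
    linarith
  have hS2 : S 2 = A 1 ^ 2 - 2 * A 2 := by
    have := hnewton 1
    simp [Finset.sum_range_succ, hA0, hS1] at this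
    linarith
  have hS3 : S 3 = A 1 ^ 3 - 3 * A 1 * A 2 + 3 * A 3 := by
    have := hnewton 2
    simp [Finset.sum_range_succ, hA0, hS1, hS2] at this
    linarith
  obtain ⟨M, hM⟩ := (hl 0).bddAbove_range
  have hmem : ∀ m, Y m ∈ Set.Icc 0 M := fun m =>
    ⟨(ht m _ (hY m)).le, by
      have := le_psum (ht m) (hY m) 1
      rw [pow_one] at this
      exact this.trans (hM ⟨m, rfl⟩)⟩
  obtain ⟨y, hy, φ, hφ, hlim⟩ := isCompact_Icc.tendsto_subseq hmem
  have hl' : ∀ k, Tendsto (fun m => psum (t (φ m)) (k + 1)) atTop (𝓝 (S (k + 1))) := fun k =>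
    (hl k).comp hφ.tendsto_atTop
  have hle : ∀ k, y ^ (k + 1) ≤ S (k + 1) := fun k =>
    le_of_tendsto_of_tendsto' (hlim.pow (k + 1)) (hl' k) fun m => le_psum (ht _) (hY _) _
  have hgeo : ∀ k, S (k + 2) ≤ y * S (k + 1) := fun k =>
    le_of_tendsto_of_tendsto' (hl' (k + 1)) (hlim.mul (hl' k)) fun m =>
      psum_succ_le (ht _) (hmax _) _
  have hconv : ∀ k, 2 * y * S (k + 2) ≤ y ^ 2 * S (k + 1) + S (k + 3) := fun k =>
    le_of_tendsto_of_tendsto' ((hlim.const_mul 2).mul (hl' (k + 1)))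
      (((hlim.pow 2).mul (hl' k)).add (hl' (k + 2))) fun m => psum_convex (ht _) _ _
  have hy0 : 0 ≤ y := hy.1
  -- Equality here would spread by convexity to a geometric progression. The remaining strict
  -- inequalities all follow from this one.
  have hstrict : S 3 < y * S 2 := by
    refine lt_of_le_of_ne (hgeo 1) fun heq => ?_
    refine not_geometric hA hA0 hdec hnewton (y := y) fun k => ?_
    induction k with
    | zero => exact heq
    | succ k ih =>
      have h1 := hconv (k + 1)
      have h2 := hgeo (k + 2)
      have h3 : S (k + 1 + 2) = y * S (k + 1 + 1) := ih
      have h4 : y * S (k + 1 + 2) = y ^ 2 * S (k + 1 + 1) := by rw [h3]; ring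
      have h5 : S (k + 2 + 2) = S (k + 1 + 3) := rfl
      have h6 : S (k + 2 + 1) = S (k + 1 + 2) := rfl
      rw [h5, h6] at h2
      linarith
  have hypos : 0 < y := by
    refine lt_of_le_of_ne hy0 fun h => ?_
    have := hle 2
    rw [← h] at hstrict this
    norm_num at this
    linarith
  have h2 : S 2 < y * S 1 := by
    have := hconv 0
    have h3 : 0 < y * (y * S 1 - S 2) := by
      norm_num at this
      nlinarith
    have := pos_of_mul_pos_right h3 hypos.le
    linarith
  have h3 : y ^ 2 < S 2 := by
    have := hle 2
    have h4 : 0 < y * (S 2 - y ^ 2) := by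
      norm_num at this
      nlinarith
    have := pos_of_mul_pos_right h4 hypos.le
    linarith
  have h1 : y < S 1 := by
    have h4 : 0 < y * (S 1 - y) := by nlinarith
    have := pos_of_mul_pos_right h4 hypos.le
    linarith
  rw [← hS3, ← hS2, ← hS1]
  exact ⟨y, hypos, ⟨φ, hφ, hlim⟩, h1, h3, h2, hstrict, hle 2⟩

end factorPoly

/-! ### Rapidly convergent alternating series and their first zero. -/

/-- The power series `∑ (-1)^n β_n w^n`. -/
noncomputable def altSeries (β : ℕ → ℝ) (w : ℂ) : ℂ := ∑' n, (((-1) ^ n * β n : ℝ) : ℂ) * w ^ n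

/-- Coefficients which decay faster than those of the exponential function. -/
def FastDecay (β : ℕ → ℝ) : Prop :=
  (∀ n, 0 < β n) ∧ Tendsto (fun n : ℕ => ((n : ℝ) + 1) * β (n + 1) / β n) atTop (𝓝 0)

namespace FastDecay

variable {β : ℕ → ℝ}

lemma summable (h : FastDecay β) {ρ : ℝ} (hρ : 0 ≤ ρ) : Summable fun n => β n * ρ ^ n := by
  -- The radius `ρ + 1` keeps all terms nonzero for the ratio test, even when `ρ = 0`.
  have key : Summable fun n => β n * (ρ + 1) ^ n := by
    refine summable_of_ratio_test_tendsto_lt_one (l := 0) one_pos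
      (Eventually.of_forall fun n => (mul_pos (h.1 n) (by positivity)).ne') ?_
    have h1 := (h.2.mul (tendsto_one_div_add_atTop_nhds_zero_nat (𝕜 := ℝ))).mul_const (ρ + 1)
    simp only [zero_mul] at h1
    refine h1.congr fun n => ?_
    have a0 := h.1 n
    have a1 := h.1 (n + 1)
    rw [Real.norm_of_nonneg (by positivity), Real.norm_of_nonneg (by positivity), pow_succ]
    field_simp
  refine key.of_nonneg_of_le (fun n => mul_nonneg (h.1 n).le (by positivity)) fun n => ?_
  exact mul_le_mul_of_nonneg_left (pow_le_pow_left₀ hρ (by linarith) n) (h.1 n).le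

lemma euler (h : FastDecay β) {κ : ℝ} (hκ : 0 ≤ κ) : FastDecay fun n => (1 + κ * n) * β n := by
  refine ⟨fun n => mul_pos (by positivity) (h.1 n), ?_⟩
  have h1 : Tendsto (fun n : ℕ => 1 + κ * ((1 : ℝ) / ((n : ℝ) + 1))) atTop (𝓝 1) := by
    simpa using (tendsto_one_div_add_atTop_nhds_zero_nat (𝕜 := ℝ)).const_mul κ |>.const_add 1
  refine squeeze_zero (fun n => ?_) (fun n => ?_) (by simpa using h.2.const_mul (1 + κ))
  · have a0 := h.1 n
    have a1 := h.1 (n + 1)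
    positivity
  · have a0 := h.1 n
    have a1 := h.1 (n + 1)
    have e : ((n : ℝ) + 1) * ((1 + κ * ((n + 1 : ℕ) : ℝ)) * β (n + 1)) / ((1 + κ * n) * β n) =
        (1 + κ * ((n + 1 : ℕ) : ℝ)) / (1 + κ * n) * (((n : ℝ) + 1) * β (n + 1) / β n) := by
      field_simp
    rw [e]
    refine mul_le_mul_of_nonneg_right ?_ (by positivity)
    rw [div_le_iff₀ (by positivity)]
    push_cast
    have : 0 ≤ κ * (κ * n) := by positivity
    nlinarith

lemma norm_term_le (h : FastDecay β) {τ : ℝ} (h0 : 0 ≤ τ) (h1 : τ ≤ 1) {w : ℂ} {ρ : ℝ}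
    (hw : ‖w‖ ≤ ρ) (n : ℕ) : ‖(((-1) ^ n * β n * τ : ℝ) : ℂ) * w ^ n‖ ≤ β n * ρ ^ n := by
  have a := h.1 n
  rw [norm_mul, norm_pow, Complex.norm_real, norm_mul, norm_mul, norm_pow, norm_neg, norm_one,
    one_pow, one_mul, Real.norm_of_nonneg a.le, Real.norm_of_nonneg h0]
  exact mul_le_mul (mul_le_of_le_one_right a.le h1) (pow_le_pow_left₀ (norm_nonneg _) hw n)
    (by positivity) a.le

lemma norm_term_le' (h : FastDecay β) {w : ℂ} {ρ : ℝ}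
    (hw : ‖w‖ ≤ ρ) (n : ℕ) : ‖(((-1) ^ n * β n : ℝ) : ℂ) * w ^ n‖ ≤ β n * ρ ^ n := by
  simpa using h.norm_term_le zero_le_one le_rfl hw n

-- Dominated convergence, with majorant `β n (‖w₀‖ + 1)^n`. The evaluation points may move, so
-- limits of zeros of the polynomials are zeros of the series.
open Polynomial in
lemma tendsto_aeval (h : FastDecay β) {P : ℕ → ℝ[X]} {τ : ℕ → ℕ → ℝ}
    (hP : ∀ m n, (P m).coeff n = (-1) ^ n * β n * τ m n) (hτ0 : ∀ m n, 0 ≤ τ m n)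
    (hτ1 : ∀ m n, τ m n ≤ 1) (hτ : ∀ n, Tendsto (fun m => τ m n) atTop (𝓝 1))
    {w : ℕ → ℂ} {w₀ : ℂ} (hw : Tendsto w atTop (𝓝 w₀)) :
    Tendsto (fun m => aeval (w m) (P m)) atTop (𝓝 (altSeries β w₀)) := by
  have e : ∀ m, aeval (w m) (P m) = ∑' n, (((-1) ^ n * β n * τ m n : ℝ) : ℂ) * w m ^ n := by
    intro m
    rw [aeval_eq_sum_range, tsum_eq_sum (s := Finset.range ((P m).natDegree + 1))]
    · refine Finset.sum_congr rfl fun n _ => ?_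
      rw [← hP, Complex.real_smul]
    · intro n hn
      rw [← hP, coeff_eq_zero_of_natDegree_lt (by simpa [Nat.lt_succ_iff] using hn)]
      simp
  simp_rw [e]
  have hbd : ∀ᶠ m in atTop, ‖w m‖ ≤ ‖w₀‖ + 1 :=
    (hw.norm.eventually (gt_mem_nhds (lt_add_one ‖w₀‖))).mono fun m hm => le_of_lt hm
  refine tendsto_tsum_of_dominated_convergence (h.summable (ρ := ‖w₀‖ + 1) (by positivity)) ?_ ?_
  · intro n
    refine Tendsto.mul ?_ (hw.pow n)
    have := (hτ n).const_mul ((-1) ^ n * β n)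
    rw [mul_one] at this
    exact (Complex.continuous_ofReal.tendsto _).comp this
  · exact hbd.mono fun m hm n => h.norm_term_le (hτ0 m n) (hτ1 m n) hm n

end FastDecay

open Polynomial in
/-- Zeros of `(1 + κ w d/dw) ∑ (-1)^n β_n w^n` for a limit of polynomials with positive zeros. -/
theorem exists_first_zero {β : ℕ → ℝ} (h : FastDecay β) (h0 : β 0 = 1) {κ : ℝ} (hκ : 0 < κ)
    {P : ℕ → ℝ[X]} {τ : ℕ → ℕ → ℝ} (hpos : ∀ m, IsPosProd (P m)) (hτpos : ∀ m, 0 < τ m 1)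
    (hP : ∀ m n, (P m).coeff n = (-1) ^ n * β n * τ m n) (hτ0 : ∀ m n, 0 ≤ τ m n)
    (hτ1 : ∀ m n, τ m n ≤ 1) (hτ : ∀ n, Tendsto (fun m => τ m n) atTop (𝓝 1))
    {A : ℕ → ℝ} (hA : ∀ n, A n = (1 + κ * n) * β n) :
    ∃ R : ℝ, 0 < R ∧ altSeries A R = 0 ∧
      (∀ w : ℂ, ‖w‖ < R → altSeries β w ≠ 0 ∧ 0 < (altSeries A w / altSeries β w).re) ∧
      0 < A 1 ^ 2 - 2 * A 2 ∧ 0 < A 1 ^ 3 - 3 * A 1 * A 2 + 3 * A 3 ∧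
      1 / A 1 < R ∧ R < A 1 / (A 1 ^ 2 - 2 * A 2) ∧ 1 / (A 1 ^ 2 - 2 * A 2) < R ^ 2 ∧
      R < (A 1 ^ 2 - 2 * A 2) / (A 1 ^ 3 - 3 * A 1 * A 2 + 3 * A 3) := by
  obtain rfl : A = fun n => (1 + κ * n) * β n := funext hA
  have hdA := h.euler hκ.le
  set A : ℕ → ℝ := fun n => (1 + κ * n) * β n with hAdef
  choose s hs hPs using hpos
  have hΦ : ∀ m, IsPosProd (P m + C κ * (X * derivative (P m))) := fun m =>
    IsPosProd.euler ⟨s m, hs m, hPs m⟩ hκ.le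
  choose t ht hΦt using hΦ
  change ∀ m, P m = factorPoly (s m) at hPs
  change ∀ m, _ = factorPoly (t m) at hΦt
  have hcoeff : ∀ m n, (factorPoly (t m)).coeff n = (-1) ^ n * A n * τ m n := by
    intro m n
    rw [← hΦt, coeff_add, coeff_C_mul, IsPosProd.coeff_X_mul_derivative, hP]
    simp only [hAdef]; ring
  have hEuler : ∀ m, factorPoly (s m) + C κ * (X * derivative (factorPoly (s m))) =
      factorPoly (t m) := fun m => by rw [← hPs, hΦt]
  have htne : ∀ m, t m ≠ 0 := by
    intro m hm
    have := hcoeff m 1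
    rw [hm] at this
    have h1 : (factorPoly 0).coeff 1 = 0 := by simp [factorPoly, coeff_one]
    rw [h1] at this
    have h2 := mul_pos (hdA.1 1) (hτpos m)
    simp only [pow_one] at this
    linarith
  have hmaxex : ∀ m, ∃ Y ∈ t m, ∀ y ∈ t m, y ≤ Y := by
    intro m
    obtain ⟨y, hy⟩ := Multiset.exists_mem_of_ne_zero (htne m)
    obtain ⟨Y, hY, hmax⟩ := (t m).toFinset.exists_max_image id ⟨y, by simpa using hy⟩
    exact ⟨Y, by simpa using hY, fun z hz => hmax z (by simpa using hz)⟩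
  choose Y hY hmax using hmaxex
  obtain ⟨y, hy, ⟨φ, hφ, hlim⟩, i1, i2, i3, i4, i5⟩ := factorPoly.exists_limit ht hY hmax hdA.1
    (by simp [hAdef, h0]) hdA.2 (fun n => by
      simp_rw [hcoeff]
      simpa using (hτ n).const_mul ((-1) ^ n * A n))
    (fun m => IsPosProd.coeff_zero ⟨t m, ht m, rfl⟩)
  have hτ' : ∀ n, Tendsto (fun m => τ (φ m) n) atTop (𝓝 1) := fun n =>
    (hτ n).comp hφ.tendsto_atTop
  have hlimA : ∀ {w : ℕ → ℂ} {w₀ : ℂ}, Tendsto w atTop (𝓝 w₀) →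
      Tendsto (fun m => aeval (w m) (factorPoly (t (φ m)))) atTop (𝓝 (altSeries A w₀)) :=
    fun hw => hdA.tendsto_aeval (fun m n => hcoeff (φ m) n) (fun _ _ => hτ0 _ _)
      (fun _ _ => hτ1 _ _) hτ' hw
  have hlimβ : ∀ {w : ℕ → ℂ} {w₀ : ℂ}, Tendsto w atTop (𝓝 w₀) →
      Tendsto (fun m => aeval (w m) (factorPoly (s (φ m)))) atTop (𝓝 (altSeries β w₀)) :=
    fun hw => h.tendsto_aeval (fun m n => by rw [← hPs]; exact hP (φ m) n) (fun _ _ => hτ0 _ _)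
      (fun _ _ => hτ1 _ _) hτ' hw
  have hS2 : 0 < A 1 ^ 2 - 2 * A 2 := (by positivity : 0 < y ^ 2).trans i2
  have hS3 : 0 < A 1 ^ 3 - 3 * A 1 * A 2 + 3 * A 3 := (by positivity : 0 < y ^ 3).trans_le i5
  -- `y` is a limit of largest reciprocal zeros, so `y⁻¹` is a limit of smallest zeros.
  refine ⟨y⁻¹, by positivity, ?_, ?_, hS2, hS3, ?_, ?_, ?_, ?_⟩
  · have hw : Tendsto (fun m => (((Y (φ m))⁻¹ : ℝ) : ℂ)) atTop (𝓝 ((y⁻¹ : ℝ) : ℂ)) :=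
      (Complex.continuous_ofReal.tendsto _).comp (hlim.inv₀ hy.ne')
    refine tendsto_nhds_unique (hlimA hw) (tendsto_const_nhds.congr fun m => ?_)
    rw [factorPoly.aeval_eq]
    symm
    refine Multiset.prod_eq_zero (Multiset.mem_map.mpr ⟨Y (φ m), hY _, ?_⟩)
    have : (Y (φ m) : ℂ) ≠ 0 := by exact_mod_cast (ht _ _ (hY (φ m))).ne'
    simp [this]
  · intro w hw
    have hw' : ‖w‖ * y < 1 := by
      rwa [← one_div, lt_div_iff₀ hy] at hw
    have hev : ∀ᶠ m in atTop, ‖w‖ * Y (φ m) < 1 :=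
      (hlim.const_mul ‖w‖).eventually (gt_mem_nhds hw')
    have hest : ∀ᶠ m in atTop, _ := hev.mono fun m hm =>
      factorPoly.estimates_of_euler (hs (φ m)) (ht (φ m)) hκ (hEuler (φ m)) (hY (φ m))
        (hmax (φ m)) hm
    have hne : altSeries β w ≠ 0 := by
      rw [← norm_pos_iff]
      exact (Real.exp_pos _).trans_le (ge_of_tendsto (hlimβ tendsto_const_nhds).norm
        (hest.mono fun m hm => hm.1))
    refine ⟨hne, ?_⟩
    have h1 : Tendsto (fun m => (aeval w (factorPoly (t (φ m))) /
        aeval w (factorPoly (s (φ m)))).re) atTop (𝓝 (altSeries A w / altSeries β w).re) :=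
      (Complex.continuous_re.tendsto _).comp
        ((hlimA tendsto_const_nhds).div (hlimβ tendsto_const_nhds) hne)
    have h2 := le_of_tendsto_of_tendsto ((hlim.const_mul ‖w‖).const_sub 1) h1
      (hest.mono fun m hm => hm.2)
    linarith
  · rw [one_div]; exact (inv_lt_inv₀ (hdA.1 1) hy).mpr i1
  · rw [lt_div_iff₀ hS2, inv_mul_lt_iff₀ hy]; exact i3
  · rw [one_div, inv_pow]; exact (inv_lt_inv₀ hS2 (by positivity)).mpr i2
  · rw [lt_div_iff₀ hS3, inv_mul_lt_iff₀ hy]; exact i4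

namespace FastDecay

variable {β : ℕ → ℝ}

lemma differentiable_altSeries (h : FastDecay β) : Differentiable ℂ (altSeries β) := by
  intro w
  have hd := Complex.differentiableOn_tsum_of_summable_norm
    (U := Metric.ball 0 (‖w‖ + 1)) (F := fun n (w : ℂ) => (((-1) ^ n * β n : ℝ) : ℂ) * w ^ n)
    (h.summable (ρ := ‖w‖ + 1) (by positivity)) (fun n => by fun_prop)
    (Metric.isOpen_ball (x := (0 : ℂ)) (ε := ‖w‖ + 1))
    fun n z hz => h.norm_term_le' (le_of_lt (by simpa using hz)) n
  exact (hd w (by simp)).differentiableAt (Metric.isOpen_ball.mem_nhds (by simp))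

lemma altSeries_euler (h : FastDecay β) (κ : ℝ) (w : ℂ) :
    altSeries β w + κ * (w * deriv (altSeries β) w) = altSeries (fun n => (1 + κ * n) * β n) w := by
  have hd := Complex.hasSum_deriv_of_summable_norm
    (U := Metric.ball 0 (‖w‖ + 1)) (F := fun n (w : ℂ) => (((-1) ^ n * β n : ℝ) : ℂ) * w ^ n)
    (h.summable (ρ := ‖w‖ + 1) (by positivity)) (fun n => by fun_prop)
    (Metric.isOpen_ball (x := (0 : ℂ)) (ε := ‖w‖ + 1))
    (fun n z hz => h.norm_term_le' (le_of_lt (by simpa using hz)) n) (z := w) (by simp)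
  have hs : HasSum (fun n => (((-1) ^ n * β n : ℝ) : ℂ) * w ^ n) (altSeries β w) :=
    (Summable.of_norm_bounded (h.summable (norm_nonneg w)) fun n => h.norm_term_le' le_rfl n).hasSum
  have := (hs.add ((hd.mul_left w).mul_left (κ : ℂ))).tsum_eq
  change _ = altSeries β w + κ * (w * deriv (altSeries β) w) at this
  rw [← this]
  refine tsum_congr fun n => ?_
  rw [deriv_const_mul _ (by fun_prop), deriv_pow_field]
  rcases n with _ | n
  · simp
  · push_cast
    rw [pow_succ w n]
    ring

lemma hasDerivAt_mul_altSeries (h : FastDecay β) {k : ℕ} (hk : 0 < k) (z : ℂ) :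
    HasDerivAt (fun z => z * altSeries β (z ^ k))
      (altSeries (fun n => (1 + (k : ℝ) * n) * β n) (z ^ k)) z := by
  have h1 : HasDerivAt (fun z => altSeries β (z ^ k))
      (deriv (altSeries β) (z ^ k) * (k * z ^ (k - 1))) z :=
    (h.differentiable_altSeries (z ^ k)).hasDerivAt.comp z (hasDerivAt_pow k z)
  have h2 := (hasDerivAt_id' z).mul h1
  refine h2.congr_deriv ?_
  obtain ⟨j, rfl⟩ := Nat.exists_eq_succ_of_ne_zero hk.ne'
  rw [← h.altSeries_euler]
  simp only [one_mul, Nat.succ_eq_add_one, Nat.add_sub_cancel]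
  push_cast
  ring

lemma mul_deriv_altSeries_pow (h : FastDecay β) {k : ℕ} (hk : 0 < k) (z : ℂ) :
    altSeries β (z ^ k) + z * deriv (fun z => altSeries β (z ^ k)) z =
      altSeries (fun n => (1 + (k : ℝ) * n) * β n) (z ^ k) := by
  have h1 : HasDerivAt (fun z => altSeries β (z ^ k))
      (deriv (altSeries β) (z ^ k) * (k * z ^ (k - 1))) z :=
    (h.differentiable_altSeries (z ^ k)).hasDerivAt.comp z (hasDerivAt_pow k z)
  have h2 : deriv (fun z => altSeries β (z ^ k)) z = _ := h1.deriv
  obtain ⟨j, rfl⟩ := Nat.exists_eq_succ_of_ne_zero hk.ne'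
  rw [← h.altSeries_euler, h2]
  simp only [Nat.succ_eq_add_one, Nat.add_sub_cancel]
  push_cast
  ring

end FastDecay

/-- The series `β` and `A` at `z^k` are `f'` and `(z f')'`, and `1 + z f''/f'` is their quotient. A
larger disk would contain the point `ρ`, where the numerator vanishes. -/
lemma radiusOfConvexity_eq {c β A : ℕ → ℝ} (hc : FastDecay c) {k : ℕ} (hk : 0 < k)
    (hβ : ∀ n, β n = (1 + (k : ℝ) * n) * c n) (hA : ∀ n, A n = (1 + (k : ℝ) * n) * β n)
    {R ρ : ℝ} (hR0 : altSeries A R = 0)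
    (hR : ∀ w : ℂ, ‖w‖ < R → altSeries β w ≠ 0 ∧ 0 < (altSeries A w / altSeries β w).re)
    (hρ : 0 < ρ) (hρR : ρ ^ k = R) :
    radiusOfConvexity 0 (fun z => z * altSeries c (z ^ k)) = ρ := by
  obtain rfl : β = fun n => (1 + (k : ℝ) * n) * c n := funext hβ
  set β : ℕ → ℝ := fun n => (1 + (k : ℝ) * n) * c n
  obtain rfl : A = fun n => (1 + (k : ℝ) * n) * β n := funext hA
  set A : ℕ → ℝ := fun n => (1 + (k : ℝ) * n) * β n
  have hdβ : FastDecay β := hc.euler k.cast_nonneg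
  have hderiv : deriv (fun z => z * altSeries c (z ^ k)) = fun z => altSeries β (z ^ k) :=
    funext fun z => (hc.hasDerivAt_mul_altSeries hk z).deriv
  have hquot : ∀ z : ℂ, altSeries β (z ^ k) ≠ 0 →
      1 + z * deriv (fun z => altSeries β (z ^ k)) z / altSeries β (z ^ k) =
        altSeries A (z ^ k) / altSeries β (z ^ k) := by
    intro z hz
    rw [← hdβ.mul_deriv_altSeries_pow hk z, add_div, div_self hz]
  refine IsGreatest.csSup_eq ⟨⟨hρ, ?_, ?_⟩, ?_⟩
  · exact fun z _ => (hc.hasDerivAt_mul_altSeries hk z).differentiableAt.differentiableWithinAt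
  · intro z hz
    have hz' : ‖z ^ k‖ < R := by
      rw [norm_pow, ← hρR]
      exact pow_lt_pow_left₀ (by simpa using hz) (norm_nonneg _) hk.ne'
    obtain ⟨h1, h2⟩ := hR _ hz'
    rw [hderiv]
    exact ⟨h1, by rw [hquot z h1]; exact h2⟩
  · rintro r ⟨hr, -, h⟩
    by_contra! hlt
    obtain ⟨h1, h2⟩ := h ρ (by simpa [abs_of_pos hρ] using hlt)
    rw [hderiv] at h1 h2
    rw [hquot _ h1] at h2
    have e : ((ρ : ℂ)) ^ k = (R : ℂ) := by exact_mod_cast congrArg Complex.ofReal hρR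
    rw [e, hR0, zero_div, Complex.zero_re] at h2
    exact lt_irrefl _ h2

/-! ### Series expansions of the Bessel function and of its normalised combinations. -/

/-- The coefficients `1 / (4^n n! (ν + 1)_n)` of the normalised Bessel function. -/
noncomputable def besselCoeff (ν : ℝ) (n : ℕ) : ℝ :=
  1 / (4 ^ n * n.factorial * risingFact (ν + 1) n)

/-- The coefficients of the normalised function `N_ν`. -/
noncomputable def besselNCoeff (a b c ν : ℝ) (n : ℕ) : ℝ :=
  quadQ a b c (ν + 2 * n) / quadQ a b c ν * besselCoeff ν n

lemma fastDecay_besselCoeff {ν : ℝ} (hν : 0 ≤ ν) : FastDecay (besselCoeff ν) := by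
  have hpos : ∀ n, 0 < risingFact (ν + 1) n := fun n => risingFact_pos (by linarith) n
  refine ⟨fun n => by have := hpos n; unfold besselCoeff; positivity, ?_⟩
  refine squeeze_zero (fun n => ?_) (fun n => ?_) (tendsto_one_div_add_atTop_nhds_zero_nat (𝕜 := ℝ))
  · have h1 := hpos n
    have h2 := hpos (n + 1)
    unfold besselCoeff
    positivity
  · have h1 := hpos n
    have h3 : 0 < ν + 1 + n := by positivity
    have e : ((n : ℝ) + 1) * besselCoeff ν (n + 1) / besselCoeff ν n = 1 / (4 * (ν + 1 + n)) := by
      unfold besselCoeff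
      rw [risingFact_succ, Nat.factorial_succ, pow_succ]
      push_cast
      field_simp
    rw [e]
    exact one_div_le_one_div_of_le (by positivity) (by linarith)

lemma Gamma_eq_risingFact {ν : ℝ} (hν : 0 ≤ ν) (n : ℕ) :
    Complex.Gamma ((n : ℂ) + (ν : ℂ) + 1) =
      (risingFact (ν + 1) n : ℂ) * Complex.Gamma ((ν : ℂ) + 1) := by
  induction n with
  | zero => simp [risingFact_zero]
  | succ n ih =>
    have hne : (n : ℂ) + (ν : ℂ) + 1 ≠ 0 := by
      have : (n : ℝ) + ν + 1 ≠ 0 := by positivity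
      exact_mod_cast this
    have e : ((n + 1 : ℕ) : ℂ) + (ν : ℂ) + 1 = ((n : ℂ) + (ν : ℂ) + 1) + 1 := by push_cast; ring
    rw [e, Complex.Gamma_add_one _ hne, ih, risingFact_succ]
    push_cast
    ring

lemma Gamma_add_one_ne_zero {ν : ℝ} (hν : 0 ≤ ν) : Complex.Gamma ((ν : ℂ) + 1) ≠ 0 := by
  refine Complex.Gamma_ne_zero_of_re_pos ?_
  simp; linarith

lemma half_cpow {z : ℂ} (hz : z ≠ 0) (s : ℂ) : (z / 2) ^ s = z ^ s / 2 ^ s := by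
  have h2 : (2 : ℂ) ≠ 0 := two_ne_zero
  have e : z = ((2 : ℝ) : ℂ) * (z / 2) := by push_cast; field_simp
  have hlog : Complex.log z = Complex.log 2 + Complex.log (z / 2) := by
    conv_lhs => rw [e]
    rw [Complex.log_ofReal_mul two_pos (div_ne_zero hz h2), Complex.ofReal_log two_pos.le]
    simp
  rw [Complex.cpow_def_of_ne_zero hz, Complex.cpow_def_of_ne_zero h2,
    Complex.cpow_def_of_ne_zero (div_ne_zero hz h2), hlog, ← Complex.exp_sub]
  congr 1
  ring

lemma besselJ_eq {ν : ℝ} (hν : 0 ≤ ν) {z : ℂ} (hz : z ≠ 0) :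
    besselJ ν z = ((2 : ℂ) ^ (ν : ℂ) * Complex.Gamma ((ν : ℂ) + 1))⁻¹ *
      (z ^ (ν : ℂ) * altSeries (besselCoeff ν) (z ^ 2)) := by
  unfold besselJ altSeries
  rw [← mul_assoc, ← tsum_mul_left]
  refine tsum_congr fun n => ?_
  have hz2 : z / 2 ≠ 0 := div_ne_zero hz two_ne_zero
  have h1 := (risingFact_pos (x := ν + 1) (by linarith) n).ne'
  have h1' : ((risingFact (ν + 1) n : ℝ) : ℂ) ≠ 0 := by exact_mod_cast h1
  have h2 := Gamma_add_one_ne_zero hν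
  have h3 : (2 : ℂ) ^ (ν : ℂ) ≠ 0 := by simp [Complex.cpow_eq_zero_iff]
  have h4 : ((n.factorial : ℕ) : ℂ) ≠ 0 := by exact_mod_cast n.factorial_ne_zero
  have e : (z / 2) ^ (2 * (n : ℂ)) = (z ^ 2) ^ n / 4 ^ n := by
    have : (2 * (n : ℂ)) = ((2 * n : ℕ) : ℂ) := by push_cast; ring
    rw [this, Complex.cpow_natCast, div_pow, pow_mul, pow_mul]
    norm_num
  rw [Complex.cpow_add _ _ hz2, e, half_cpow hz, Gamma_eq_risingFact hν]
  unfold besselCoeff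
  push_cast
  field_simp

/-- Termwise `μ + 2n = (μ - 1) + (1 + 2n)`. The result is again made of powers times such series, so
it can be differentiated a second time. -/
lemma hasDerivAt_cpow_mul_altSeries {β : ℕ → ℝ} (h : FastDecay β) (μ : ℂ) {z : ℂ}
    (hz : z ∈ Complex.slitPlane) :
    HasDerivAt (fun z => z ^ μ * altSeries β (z ^ 2)) (z ^ (μ - 1) * ((μ - 1) * altSeries β (z ^ 2) +
      altSeries (fun n => (1 + ((2 : ℕ) : ℝ) * n) * β n) (z ^ 2))) z := by
  have hz0 := Complex.slitPlane_ne_zero hz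
  have hd : DifferentiableAt ℂ (fun z => altSeries β (z ^ 2)) z :=
    (h.differentiable_altSeries.comp (differentiable_pow 2)).differentiableAt
  refine (((hasDerivAt_id' z).cpow_const hz).mul hd.hasDerivAt).congr_deriv ?_
  rw [← h.mul_deriv_altSeries_pow two_pos]
  have e : z ^ μ = z ^ (μ - 1) * z := by
    rw [Complex.cpow_sub _ _ hz0, Complex.cpow_one, div_mul_cancel₀ _ hz0]
  rw [e]
  ring

lemma FastDecay.hasSum {β : ℕ → ℝ} (h : FastDecay β) (w : ℂ) :
    HasSum (fun n => (((-1) ^ n * β n : ℝ) : ℂ) * w ^ n) (altSeries β w) :=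
  (Summable.of_norm_bounded (h.summable (norm_nonneg w)) fun n => h.norm_term_le' le_rfl n).hasSum

lemma besselN_eq {a b c ν : ℝ} (hν : 0 ≤ ν) (hQ : quadQ a b c ν ≠ 0) {z : ℂ}
    (hz : z ∈ Complex.slitPlane) :
    besselN a b c ν z = ((2 : ℂ) ^ (ν : ℂ) * Complex.Gamma ((ν : ℂ) + 1))⁻¹ *
      (z ^ (ν : ℂ) * (quadQ a b c ν * altSeries (besselNCoeff a b c ν) (z ^ 2))) := by
  have hz0 := Complex.slitPlane_ne_zero hz
  have hd0 := fastDecay_besselCoeff hν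
  have hd1 := hd0.euler (κ := ((2 : ℕ) : ℝ)) (by positivity)
  have hd2 := hd1.euler (κ := ((2 : ℕ) : ℝ)) (by positivity)
  set K := ((2 : ℂ) ^ (ν : ℂ) * Complex.Gamma ((ν : ℂ) + 1))⁻¹
  set E0 := altSeries (besselCoeff ν)
  set E1 := altSeries (fun n => (1 + ((2 : ℕ) : ℝ) * n) * besselCoeff ν n)
  set E2 := altSeries (fun n => (1 + ((2 : ℕ) : ℝ) * n) *
    ((1 + ((2 : ℕ) : ℝ) * n) * besselCoeff ν n))
  have hJ1 : ∀ z ∈ Complex.slitPlane, HasDerivAt (besselJ ν)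
      (K * (z ^ ((ν : ℂ) - 1) * ((ν - 1) * E0 (z ^ 2) + E1 (z ^ 2)))) z := by
    intro z hz
    refine ((hasDerivAt_cpow_mul_altSeries hd0 ν hz).const_mul K).congr_of_eventuallyEq ?_
    filter_upwards [Complex.isOpen_slitPlane.mem_nhds hz] with u hu
    exact besselJ_eq hν (Complex.slitPlane_ne_zero hu)
  have hJ2 : HasDerivAt (deriv (besselJ ν)) (K * ((ν - 1) *
      (z ^ ((ν : ℂ) - 1 - 1) * ((ν - 1 - 1) * E0 (z ^ 2) + E1 (z ^ 2))) +
        z ^ ((ν : ℂ) - 1 - 1) * ((ν - 1 - 1) * E1 (z ^ 2) + E2 (z ^ 2)))) z := by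
    refine ((((hasDerivAt_cpow_mul_altSeries hd0 (ν - 1) hz).const_mul ((ν : ℂ) - 1)).add
      (hasDerivAt_cpow_mul_altSeries hd1 (ν - 1) hz)).const_mul K).congr_of_eventuallyEq ?_
    filter_upwards [Complex.isOpen_slitPlane.mem_nhds hz] with u hu
    rw [(hJ1 u hu).deriv]
    simp only [Pi.add_apply]
    ring
  -- This expands `Q(ν + 2n)` in powers of `1 + 2n`, the multiplier that separates `E0`, `E1` and
  -- `E2`.
  have hser : (quadQ a b c ν : ℂ) * altSeries (besselNCoeff a b c ν) (z ^ 2) =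
      a * ((ν - 1) * (ν - 2) * E0 (z ^ 2) + (2 * ν - 3) * E1 (z ^ 2) + E2 (z ^ 2)) +
        b * ((ν - 1) * E0 (z ^ 2) + E1 (z ^ 2)) + c * E0 (z ^ 2) := by
    have h0 := hd0.hasSum (z ^ 2)
    have h1 := hd1.hasSum (z ^ 2)
    have h2 := hd2.hasSum (z ^ 2)
    have := (((((h0.mul_left (((ν : ℂ) - 1) * (ν - 2))).add (h1.mul_left (2 * (ν : ℂ) - 3))).add
      h2).mul_left (a : ℂ)).add (((h0.mul_left ((ν : ℂ) - 1)).add h1).mul_left (b : ℂ))).add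
        (h0.mul_left (c : ℂ))
    rw [← this.tsum_eq]
    unfold altSeries
    rw [← tsum_mul_left]
    refine tsum_congr fun n => ?_
    have hQ' : (quadQ a b c ν : ℂ) ≠ 0 := by exact_mod_cast hQ
    have e : (quadQ a b c ν : ℂ) * ((((-1) ^ n * besselNCoeff a b c ν n : ℝ) : ℂ) * (z ^ 2) ^ n) =
        ((-1) ^ n * (quadQ a b c (ν + 2 * n) * besselCoeff ν n)) * (z ^ 2) ^ n := by
      unfold besselNCoeff
      push_cast
      field_simp
    rw [e]
    unfold quadQ
    push_cast
    ring
  have e2 : z ^ (ν : ℂ) = z ^ ((ν : ℂ) - 1 - 1) * z ^ 2 := by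
    rw [Complex.cpow_sub _ _ hz0, Complex.cpow_sub _ _ hz0, Complex.cpow_one]
    field_simp
  have e1 : z ^ ((ν : ℂ) - 1) = z ^ ((ν : ℂ) - 1 - 1) * z := by
    rw [Complex.cpow_sub ((ν : ℂ) - 1) 1 hz0, Complex.cpow_one, div_mul_cancel₀ _ hz0]
  unfold besselN
  rw [hJ2.deriv, (hJ1 z hz).deriv, besselJ_eq hν hz0, hser, e2, e1]
  ring

lemma mem_closure_slitPlane (z : ℂ) : z ∈ closure Complex.slitPlane := by
  by_cases hz : z ∈ Complex.slitPlane
  · exact subset_closure hz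
  refine Metric.mem_closure_iff.mpr fun ε hε => ⟨z + (ε / 2 : ℝ) * Complex.I, ?_, ?_⟩
  · rw [Complex.mem_slitPlane_iff] at hz ⊢
    push Not at hz
    right
    simp [hz.2, hε.ne']
  · rw [dist_eq_norm]
    simp [abs_of_pos hε]
    linarith

/-- The slit plane is dense, so the continuous extension across the cut is the entire series. -/
lemma extendFrom_slitPlane_eq {f g : ℂ → ℂ} (hg : Continuous g)
    (h : ∀ z ∈ Complex.slitPlane, f z = g z) : extendFrom Complex.slitPlane f = g := by
  ext z
  refine extendFrom_eq (mem_closure_slitPlane z) ?_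
  refine (hg.tendsto z).mono_left nhdsWithin_le_nhds |>.congr' ?_
  filter_upwards [self_mem_nhdsWithin] with u hu using (h u hu).symm

section Normalised

variable {a b c ν : ℝ}

lemma gNorm_eq (hν : 0 ≤ ν) (hQ : quadQ a b c ν ≠ 0) (hd : FastDecay (besselNCoeff a b c ν)) :
    gNorm a b c ν = fun z => z * altSeries (besselNCoeff a b c ν) (z ^ 2) := by
  refine extendFrom_slitPlane_eq (continuous_id.mul
    (hd.differentiable_altSeries.continuous.comp (continuous_pow 2))) fun z hz => ?_
  have hz0 := Complex.slitPlane_ne_zero hz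
  have hQ' : (quadQ a b c ν : ℂ) ≠ 0 := by exact_mod_cast hQ
  have h2 := Gamma_add_one_ne_zero hν
  have h3 : (2 : ℂ) ^ (ν : ℂ) ≠ 0 := by simp [Complex.cpow_eq_zero_iff]
  have h4 : z ^ (ν : ℂ) ≠ 0 := by simp [Complex.cpow_eq_zero_iff, hz0]
  rw [besselN_eq hν hQ hz, Complex.cpow_sub _ _ hz0, Complex.cpow_one]
  field_simp

lemma cpow_half_mem_slitPlane {z : ℂ} (hz : z ∈ Complex.slitPlane) :
    z ^ (1 / 2 : ℂ) ∈ Complex.slitPlane := by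
  have hz0 := Complex.slitPlane_ne_zero hz
  rw [Complex.mem_slitPlane_iff]
  left
  rw [Complex.cpow_def_of_ne_zero hz0, Complex.exp_re]
  have e : (Complex.log z * (1 / 2)).im = z.arg / 2 := by
    rw [mul_one_div, show (2 : ℂ) = ((2 : ℝ) : ℂ) by simp, Complex.div_ofReal_im, Complex.log_im]
  rw [e]
  refine mul_pos (Real.exp_pos _) (Real.cos_pos_of_mem_Ioo ⟨?_, ?_⟩)
  · linarith [Complex.neg_pi_lt_arg z]
  · have := lt_of_le_of_ne (Complex.arg_le_pi z) (Complex.mem_slitPlane_iff_arg.mp hz).1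
    linarith

lemma hNorm_eq (hν : 0 ≤ ν) (hQ : quadQ a b c ν ≠ 0) (hd : FastDecay (besselNCoeff a b c ν)) :
    hNorm a b c ν = fun z => z * altSeries (besselNCoeff a b c ν) (z ^ 1) := by
  refine extendFrom_slitPlane_eq (continuous_id.mul
    (hd.differentiable_altSeries.continuous.comp (continuous_pow 1))) fun z hz => ?_
  have hz0 := Complex.slitPlane_ne_zero hz
  have hQ' : (quadQ a b c ν : ℂ) ≠ 0 := by exact_mod_cast hQ
  have h2 := Gamma_add_one_ne_zero hν
  have h3 : (2 : ℂ) ^ (ν : ℂ) ≠ 0 := by simp [Complex.cpow_eq_zero_iff]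
  have h4 : z ^ ((ν : ℂ) / 2) ≠ 0 := by simp [Complex.cpow_eq_zero_iff, hz0]
  have e : (Complex.log z * (1 / 2)).im = z.arg / 2 := by
    rw [mul_one_div, show (2 : ℂ) = ((2 : ℝ) : ℂ) by simp, Complex.div_ofReal_im, Complex.log_im]
  -- Powers compose here because halving the argument stays within the principal branch.
  have e1 : (z ^ (1 / 2 : ℂ)) ^ (ν : ℂ) = z ^ ((ν : ℂ) / 2) := by
    rw [← Complex.cpow_mul]
    · congr 1; ring
    · rw [e]; linarith [Complex.neg_pi_lt_arg z, Real.pi_pos]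
    · rw [e]; linarith [Complex.arg_le_pi z, Real.pi_pos]
  have e2 : (z ^ (1 / 2 : ℂ)) ^ 2 = z ^ 1 := by
    have := Complex.cpow_nat_inv_pow z two_ne_zero
    rw [pow_one, one_div]
    exact_mod_cast this
  rw [besselN_eq hν hQ (cpow_half_mem_slitPlane hz), e1, e2, Complex.cpow_sub _ _ hz0,
    Complex.cpow_one]
  field_simp

end Normalised

lemma tendsto_descFactorial_div_pow (n : ℕ) :
    Tendsto (fun m : ℕ => ((m + 1).descFactorial n : ℝ) / ((m + 1 : ℕ) : ℝ) ^ n) atTop (𝓝 1) := by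
  induction n with
  | zero => simp
  | succ n ih =>
    have h1 : Tendsto (fun m : ℕ => 1 - (n : ℝ) * (1 / ((m : ℝ) + 1))) atTop (𝓝 1) := by
      simpa using ((tendsto_one_div_add_atTop_nhds_zero_nat (𝕜 := ℝ)).const_mul (n : ℝ)).const_sub 1
    have h2 := h1.mul ih
    rw [one_mul] at h2
    refine h2.congr' ?_
    filter_upwards [eventually_ge_atTop n] with m hm
    have hm' : (m : ℝ) + 1 ≠ 0 := by positivity
    rw [Nat.descFactorial_succ, Nat.cast_mul, Nat.cast_sub (by omega), pow_succ]
    push_cast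
    field_simp

/-! ### The weight `Q(ν + 2n)/Q(ν)` and the resulting zero. -/

section Quadratic

variable {a b c ν : ℝ}

/-- This fixes `x = ν + 1`, `γ = 2(b - a)/Q(ν)` and `A = 4a/Q(ν)` in the Laguerre weights. -/
lemma quadQ_add_two_mul (hQ : quadQ a b c ν ≠ 0) (t : ℝ) :
    1 + (2 * (b - a) / quadQ a b c ν + 4 * a / quadQ a b c ν * (ν + 1 - 1)) * t +
      4 * a / quadQ a b c ν * t ^ 2 = quadQ a b c (ν + 2 * t) / quadQ a b c ν := by
  field_simp
  unfold quadQ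
  ring

lemma quadratic_ne_zero (hν₀ : ∀ x : ℝ, quadQ a b c x = 0 → x ≤ ν) (hQ : quadQ a b c ν ≠ 0)
    (t : ℝ) (ht : 0 ≤ t) :
    1 + (2 * (b - a) / quadQ a b c ν + 4 * a / quadQ a b c ν * (ν + 1 - 1)) * t +
      4 * a / quadQ a b c ν * t ^ 2 ≠ 0 := by
  rw [quadQ_add_two_mul hQ]
  refine div_ne_zero (fun h => ?_) hQ
  have := hν₀ _ h
  obtain rfl : t = 0 := by linarith
  simp at h
  exact hQ h

/-- Up to a positive factor the discriminant is `(b - a)² - 4ac`. If it is negative then `ac > 0`,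
which excludes `c = 0` and leaves `a, c, b - a > 0`. -/
lemma quadratic_disc (habc : (c = 0 ∧ a ≠ b) ∨ (0 < c ∧ a < b)) (hν : 0 ≤ ν)
    (hQ : quadQ a b c ν ≠ 0)
    (hd : (2 * (b - a) / quadQ a b c ν + 4 * a / quadQ a b c ν * (ν + 1 - 1)) ^ 2 -
      4 * (4 * a / quadQ a b c ν) < 0) :
    0 ≤ 2 * (b - a) / quadQ a b c ν ∧ 0 < 4 * a / quadQ a b c ν := by
  have e : (2 * (b - a) / quadQ a b c ν + 4 * a / quadQ a b c ν * (ν + 1 - 1)) ^ 2 -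
      4 * (4 * a / quadQ a b c ν) = 4 * ((b - a) ^ 2 - 4 * (a * c)) / quadQ a b c ν ^ 2 := by
    field_simp
    unfold quadQ
    ring
  rw [e] at hd
  have h1 : (b - a) ^ 2 - 4 * (a * c) < 0 := by
    by_contra! h
    exact absurd hd (not_lt.mpr (by positivity))
  have h2 : 0 < a * c := by nlinarith [sq_nonneg (b - a)]
  rcases habc with ⟨rfl, -⟩ | ⟨hc, hab⟩
  · simp at h2
  · have ha : 0 < a := pos_of_mul_pos_left h2 hc.le
    have hpos : 0 < quadQ a b c ν := by
      have : quadQ a b c ν = a * ν ^ 2 + (b - a) * ν + c := by unfold quadQ; ring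
      rw [this]
      have : 0 < b - a := by linarith
      positivity
    have : 0 < b - a := by linarith
    constructor <;> positivity

lemma quadQ_div_pos (hν₀ : ∀ x : ℝ, quadQ a b c x = 0 → x ≤ ν) (hQ : quadQ a b c ν ≠ 0)
    {x : ℝ} (hx : ν ≤ x) : 0 < quadQ a b c x / quadQ a b c ν := by
  by_contra hle
  push Not at hle
  have hcont : ContinuousOn (fun t : ℝ => quadQ a b c t / quadQ a b c ν) (Set.Icc ν x) := by
    unfold quadQ
    fun_prop
  obtain ⟨u, hu, hu0⟩ := intermediate_value_Icc' hx hcont (show (0 : ℝ) ∈ Set.Icc _ _ from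
    ⟨hle, by simp [div_self hQ]⟩)
  have h0 : quadQ a b c u = 0 := (div_eq_zero_iff.mp hu0).resolve_right hQ
  have := hν₀ u h0
  have : u = ν := le_antisymm this hu.1
  exact hQ (this ▸ h0)

lemma fastDecay_besselNCoeff (habc : (c = 0 ∧ a ≠ b) ∨ (0 < c ∧ a < b)) (hν : 0 ≤ ν)
    (hν₀ : ∀ x : ℝ, quadQ a b c x = 0 → x ≤ ν) (hQ : quadQ a b c ν ≠ 0) :
    FastDecay (besselNCoeff a b c ν) := by
  have hd := fastDecay_besselCoeff hν
  have hpos : ∀ n : ℕ, 0 < quadQ a b c (ν + 2 * n) / quadQ a b c ν := fun n =>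
    quadQ_div_pos hν₀ hQ (by linarith [(n.cast_nonneg : (0 : ℝ) ≤ n)])
  have hpos' : ∀ n, 0 < besselNCoeff a b c ν n := fun n => mul_pos (hpos n) (hd.1 n)
  refine ⟨hpos', ?_⟩
  have hnn : 0 ≤ 4 * a / quadQ a b c ν ∧
      0 ≤ 2 * (b - a) / quadQ a b c ν + 4 * a / quadQ a b c ν * (ν + 1 - 1) := by
    by_cases h : (2 * (b - a) / quadQ a b c ν + 4 * a / quadQ a b c ν * (ν + 1 - 1)) ^ 2 -
      4 * (4 * a / quadQ a b c ν) < 0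
    · obtain ⟨h1, h2⟩ := quadratic_disc habc hν hQ h
      refine ⟨h2.le, add_nonneg h1 (mul_nonneg h2.le (by linarith))⟩
    · exact nonneg_of_no_zero (not_lt.mp h) (quadratic_ne_zero hν₀ hQ)
  -- The factor `4` comes from `n + 1 ≤ 2n`, hence the restriction to `n ≥ 1`.
  have hratio : ∀ n : ℕ, 1 ≤ n → quadQ a b c (ν + 2 * ((n + 1 : ℕ) : ℝ)) / quadQ a b c ν ≤
      4 * (quadQ a b c (ν + 2 * n) / quadQ a b c ν) := by
    intro n hn
    rw [← quadQ_add_two_mul hQ, ← quadQ_add_two_mul hQ]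
    obtain ⟨h1, h2⟩ := hnn
    have hn' : (1 : ℝ) ≤ n := by exact_mod_cast hn
    push_cast
    have h3 := mul_nonneg h2 (by linarith : (0 : ℝ) ≤ 4 * n - (n + 1))
    have h4 := mul_nonneg h1 (by nlinarith : (0 : ℝ) ≤ 4 * (n : ℝ) ^ 2 - (n + 1) ^ 2)
    linarith
  refine squeeze_zero' (Eventually.of_forall fun n => ?_) ?_ (by simpa using hd.2.const_mul 4)
  · have h1 := hpos' n
    have h2 := hpos' (n + 1)
    positivity
  · filter_upwards [eventually_ge_atTop 1] with n hn
    have h1 := hpos n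
    have h2 := hd.1 n
    have h3 := hd.1 (n + 1)
    unfold besselNCoeff
    rw [div_le_iff₀ (mul_pos h1 h2)]
    calc _ ≤ ((n : ℝ) + 1) * (4 * (quadQ a b c (ν + 2 * n) / quadQ a b c ν) *
          besselCoeff ν (n + 1)) := by
          gcongr
          exact hratio n hn
      _ = _ := by field_simp

/-- The first zero governing the radius of convexity of `z ∑ (-1)^n c_n z^(kn)`. -/
lemma exists_convexity_zero (habc : (c = 0 ∧ a ≠ b) ∨ (0 < c ∧ a < b)) (hν : 0 ≤ ν)
    (hν₀ : ∀ x : ℝ, quadQ a b c x = 0 → x ≤ ν) (hQ : quadQ a b c ν ≠ 0) {k : ℕ} (hk : 0 < k)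
    {A : ℕ → ℝ} (hA : ∀ n, A n = (1 + (k : ℝ) * n) * ((1 + (k : ℝ) * n) * besselNCoeff a b c ν n)) :
    ∃ R : ℝ, 0 < R ∧ (∀ ρ : ℝ, 0 < ρ → ρ ^ k = R →
      radiusOfConvexity 0 (fun z => z * altSeries (besselNCoeff a b c ν) (z ^ k)) = ρ) ∧
      0 < A 1 ^ 2 - 2 * A 2 ∧ 0 < A 1 ^ 3 - 3 * A 1 * A 2 + 3 * A 3 ∧
      1 / A 1 < R ∧ R < A 1 / (A 1 ^ 2 - 2 * A 2) ∧ 1 / (A 1 ^ 2 - 2 * A 2) < R ^ 2 ∧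
      R < (A 1 ^ 2 - 2 * A 2) / (A 1 ^ 3 - 3 * A 1 * A 2 + 3 * A 3) := by
  have hd := fastDecay_besselNCoeff habc hν hν₀ hQ
  have hP := fun m : ℕ => IsPosProd.exists_bessel_approx (x := ν + 1) (κ := k) (by linarith)
    k.cast_nonneg (quadratic_ne_zero hν₀ hQ) (quadratic_disc habc hν hQ) m.succ_pos
  choose P hpos hcoeff using hP
  have hpow : ∀ m : ℕ, (0 : ℝ) < ((m + 1 : ℕ) : ℝ) := fun m => by positivity
  -- The approximants already carry one factor `1 + kn`, for `f'`; the second is applied inside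
  -- `exists_first_zero`. The degree `m + 1` avoids division by zero.
  obtain ⟨R, hR, hR0, hdisk, h⟩ := exists_first_zero (hd.euler (κ := k) k.cast_nonneg)
    (by simp [besselNCoeff, besselCoeff, risingFact_zero, div_self hQ])
    (κ := k) (by exact_mod_cast hk) (P := P)
    (τ := fun m n => ((m + 1).descFactorial n : ℝ) / ((m + 1 : ℕ) : ℝ) ^ n) hpos
    (fun m => by simpa using div_pos (hpow m) (hpow m)) (fun m n => by
      rw [hcoeff, quadQ_add_two_mul hQ]
      simp only [besselNCoeff, besselCoeff, mul_one_div]) (fun m n => by positivity)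
    (fun m n => by
      rw [div_le_one (pow_pos (hpow m) n)]
      exact_mod_cast Nat.descFactorial_le_pow (m + 1) n) tendsto_descFactorial_div_pow hA
  exact ⟨R, hR, fun ρ hρ hρR => radiusOfConvexity_eq hd hk (fun _ => rfl) hA hR0 hdisk hρ hρR, h⟩

end Quadratic

/-! ### The explicit bounds. -/

theorem theorem5 (a b c ν : ℝ)
    (habc : (c = 0 ∧ a ≠ b) ∨ (0 < c ∧ a < b))
    (hν : 0 ≤ ν)
    (hν₀ : ∀ x : ℝ, quadQ a b c x = 0 → x ≤ ν)
    (hQ : quadQ a b c ν ≠ 0) :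
    let Q : ℝ → ℝ := quadQ a b c
    let rg : ℝ := radiusOfConvexity 0 (gNorm a b c ν)
    let rh : ℝ := radiusOfConvexity 0 (hNorm a b c ν)
    ((2 / 3 * √((ν + 1) * Q ν / Q (ν + 2)) < rg ∧
      rg < √(36 * (ν + 1) * (ν + 2) * Q ν * Q (ν + 2) /
        (81 * (ν + 2) * Q (ν + 2) ^ 2 - 25 * (ν + 1) * Q ν * Q (ν + 4)))) ∧
     ((16 * (ν + 1) ^ 2 * (ν + 2) * Q ν ^ 2 /
        (81 * (ν + 2) * Q (ν + 2) ^ 2 - 25 * (ν + 1) * Q ν * Q (ν + 4))) ^ (1 / 4 : ℝ) < rg ∧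
      rg < √(8 * (ν + 1) * (ν + 3) * Q ν *
          (81 * (ν + 2) * Q (ν + 2) ^ 2 - 25 * (ν + 1) * Q ν * Q (ν + 4)) /
        (27 * (ν + 3) * Q (ν + 2) *
            (54 * (ν + 2) * Q (ν + 2) ^ 2 - 25 * (ν + 1) * Q ν * Q (ν + 4))
          + 49 * (ν + 1) ^ 2 * Q ν ^ 2 * Q (ν + 6))))) ∧
    (((ν + 1) * Q ν / Q (ν + 2) < rh ∧
      rh < 16 * (ν + 1) * (ν + 2) * Q ν * Q (ν + 2) /
        (16 * (ν + 2) * Q (ν + 2) ^ 2 - 9 * (ν + 1) * Q ν * Q (ν + 4))) ∧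
     (√(16 * (ν + 1) ^ 2 * (ν + 2) * Q ν ^ 2 /
        (16 * (ν + 2) * Q (ν + 2) ^ 2 - 9 * (ν + 1) * Q ν * Q (ν + 4))) < rh ∧
      rh < 2 * (ν + 1) * (ν + 3) * Q ν *
          (16 * (ν + 2) * Q (ν + 2) ^ 2 - 9 * (ν + 1) * Q ν * Q (ν + 4)) /
        ((ν + 3) * Q (ν + 2) *
            (32 * (ν + 2) * Q (ν + 2) ^ 2 - 27 * (ν + 1) * Q ν * Q (ν + 4))
          + 4 * (ν + 1) ^ 2 * Q ν ^ 2 * Q (ν + 6)))) := by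
  intro Q rg rh
  have hd := fastDecay_besselNCoeff habc hν hν₀ hQ
  have h0 : Q ν ≠ 0 := hQ
  have hQne : ∀ x, ν ≤ x → Q x ≠ 0 := fun x hx h => (quadQ_div_pos hν₀ hQ hx).ne' (by
    change Q x / _ = 0
    rw [h, zero_div])
  have h2 : Q (ν + 2) ≠ 0 := hQne _ (by linarith)
  have hν1 : 0 < ν + 1 := by linarith
  have hν2 : 0 < ν + 2 := by linarith
  have hν3 : 0 < ν + 3 := by linarith
  have c1 : besselNCoeff a b c ν 1 = Q (ν + 2) / (4 * (ν + 1) * Q ν) := by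
    simp only [besselNCoeff, besselCoeff, risingFact, Finset.prod_range_succ, Finset.prod_range_zero,
      Nat.factorial]
    norm_num
    change Q (ν + 2) / Q ν * _ = _
    field_simp
  have c2 : besselNCoeff a b c ν 2 = Q (ν + 4) / (32 * (ν + 1) * (ν + 2) * Q ν) := by
    have e : ν + 1 + 1 = ν + 2 := by ring
    simp only [besselNCoeff, besselCoeff, risingFact, Finset.prod_range_succ, Finset.prod_range_zero,
      Nat.factorial]
    norm_num [e]
    change Q (ν + 4) / Q ν * _ = _
    field_simp
  have c3 : besselNCoeff a b c ν 3 = Q (ν + 6) / (384 * (ν + 1) * (ν + 2) * (ν + 3) * Q ν) := by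
    have e : ν + 1 + 1 = ν + 2 := by ring
    have e' : ν + 1 + 2 = ν + 3 := by ring
    simp only [besselNCoeff, besselCoeff, risingFact, Finset.prod_range_succ, Finset.prod_range_zero,
      Nat.factorial]
    norm_num [e, e']
    change Q (ν + 6) / Q ν * _ = _
    field_simp
  constructor
  · obtain ⟨A, hA⟩ : ∃ A : ℕ → ℝ, ∀ n, A n = (1 + ((2 : ℕ) : ℝ) * n) *
      ((1 + ((2 : ℕ) : ℝ) * n) * besselNCoeff a b c ν n) := ⟨_, fun _ => rfl⟩
    obtain ⟨R, hR, hrad, p2, p3, i1, i2, i3, i4⟩ :=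
      exists_convexity_zero habc hν hν₀ hQ two_pos hA
    have hrg : rg = √R := by
      rw [← hrad (√R) (Real.sqrt_pos.mpr hR) (Real.sq_sqrt hR.le), ← gNorm_eq hν hQ hd]
    have a1 : A 1 = 9 * Q (ν + 2) / (4 * (ν + 1) * Q ν) := by
      rw [hA, c1]; push_cast; ring
    have a2 : A 2 = 25 * Q (ν + 4) / (32 * (ν + 1) * (ν + 2) * Q ν) := by
      rw [hA, c2]; push_cast; ring
    have a3 : A 3 = 49 * Q (ν + 6) / (384 * (ν + 1) * (ν + 2) * (ν + 3) * Q ν) := by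
      rw [hA, c3]; push_cast; ring
    set K := 81 * (ν + 2) * Q (ν + 2) ^ 2 - 25 * (ν + 1) * Q ν * Q (ν + 4) with hK
    set D := 27 * (ν + 3) * Q (ν + 2) *
            (54 * (ν + 2) * Q (ν + 2) ^ 2 - 25 * (ν + 1) * Q ν * Q (ν + 4))
          + 49 * (ν + 1) ^ 2 * Q ν ^ 2 * Q (ν + 6) with hD
    -- The second and third Rayleigh sums `S_2` and `S_3`: `K` and `D` are their numerators.
    have s2 : A 1 ^ 2 - 2 * A 2 = K / (16 * (ν + 1) ^ 2 * (ν + 2) * Q ν ^ 2) := by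
      rw [a1, a2, hK]; field_simp; ring
    have s3 : A 1 ^ 3 - 3 * A 1 * A 2 + 3 * A 3 =
        D / (128 * (ν + 1) ^ 3 * (ν + 2) * (ν + 3) * Q ν ^ 3) := by
      rw [a1, a2, a3, hD]; field_simp; ring
    rw [s2] at p2 i2 i3 i4
    rw [s3] at p3 i4
    have hK0 : K ≠ 0 := by intro h; simp [h] at p2
    have hD0 : D ≠ 0 := by intro h; simp [h] at p3
    rw [a1] at i1 i2
    rw [hrg]
    refine ⟨⟨?_, ?_⟩, ?_, ?_⟩
    · have e : (2 / 3 : ℝ) = √(4 / 9) := by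
        rw [show (4 / 9 : ℝ) = (2 / 3) ^ 2 by norm_num, Real.sqrt_sq (by norm_num)]
      rw [e, ← Real.sqrt_mul (by norm_num)]
      refine Real.sqrt_lt_sqrt ?_ (lt_of_eq_of_lt ?_ i1)
      · have := quadQ_div_pos hν₀ hQ (x := ν + 2) (by linarith)
        have h3 : 0 < Q ν / Q (ν + 2) := by rw [← inv_div]; exact inv_pos.mpr this
        rw [mul_div_assoc]
        positivity
      · field_simp
    · refine Real.sqrt_lt_sqrt hR.le (lt_of_lt_of_eq i2 ?_)
      field_simp
      norm_num
    -- The bound `1/S_2 < R²` concerns the fourth power of the radius, whence the fourth root.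
    · have e : √R = (R ^ 2) ^ (1 / 4 : ℝ) := by
        rw [Real.sqrt_eq_rpow, ← Real.rpow_natCast, ← Real.rpow_mul hR.le]
        norm_num
      rw [e]
      have e1 : 16 * (ν + 1) ^ 2 * (ν + 2) * Q ν ^ 2 / K =
          1 / (K / (16 * (ν + 1) ^ 2 * (ν + 2) * Q ν ^ 2)) := by rw [one_div_div]
      rw [e1]
      exact Real.rpow_lt_rpow (one_div_pos.mpr p2).le i3 (by norm_num)
    · refine Real.sqrt_lt_sqrt hR.le (lt_of_lt_of_eq i4 ?_)
      field_simp
      norm_num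
  · obtain ⟨A, hA⟩ : ∃ A : ℕ → ℝ, ∀ n, A n = (1 + ((1 : ℕ) : ℝ) * n) *
      ((1 + ((1 : ℕ) : ℝ) * n) * besselNCoeff a b c ν n) := ⟨_, fun _ => rfl⟩
    obtain ⟨R, hR, hrad, p2, p3, i1, i2, i3, i4⟩ :=
      exists_convexity_zero habc hν hν₀ hQ one_pos hA
    have hrh : rh = R := by
      rw [← hrad R hR (pow_one R), ← hNorm_eq hν hQ hd]
    have a1 : A 1 = Q (ν + 2) / ((ν + 1) * Q ν) := by
      rw [hA, c1]; push_cast; field_simp; norm_num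
    have a2 : A 2 = 9 * Q (ν + 4) / (32 * (ν + 1) * (ν + 2) * Q ν) := by
      rw [hA, c2]; push_cast; ring
    have a3 : A 3 = Q (ν + 6) / (24 * (ν + 1) * (ν + 2) * (ν + 3) * Q ν) := by
      rw [hA, c3]; push_cast; field_simp; ring
    set K := 16 * (ν + 2) * Q (ν + 2) ^ 2 - 9 * (ν + 1) * Q ν * Q (ν + 4) with hK
    set D := (ν + 3) * Q (ν + 2) *
            (32 * (ν + 2) * Q (ν + 2) ^ 2 - 27 * (ν + 1) * Q ν * Q (ν + 4))
          + 4 * (ν + 1) ^ 2 * Q ν ^ 2 * Q (ν + 6) with hD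
    have s2 : A 1 ^ 2 - 2 * A 2 = K / (16 * (ν + 1) ^ 2 * (ν + 2) * Q ν ^ 2) := by
      rw [a1, a2, hK]; field_simp; ring
    have s3 : A 1 ^ 3 - 3 * A 1 * A 2 + 3 * A 3 =
        D / (32 * (ν + 1) ^ 3 * (ν + 2) * (ν + 3) * Q ν ^ 3) := by
      rw [a1, a2, a3, hD]; field_simp; ring
    rw [s2] at p2 i2 i3 i4
    rw [s3] at p3 i4
    have hK0 : K ≠ 0 := by intro h; simp [h] at p2
    have hD0 : D ≠ 0 := by intro h; simp [h] at p3
    rw [a1] at i1 i2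
    rw [hrh]
    refine ⟨⟨?_, ?_⟩, ?_, ?_⟩
    · rwa [one_div_div] at i1
    · refine lt_of_lt_of_eq i2 ?_
      field_simp
    · rw [Real.sqrt_lt' hR]
      rwa [one_div_div] at i3
    · refine lt_of_lt_of_eq i4 ?_
      field_simp
      norm_num
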